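/- A \emph{triangulation} is a finite simple graph embedded in the plane (given combinatorially, by the cyclic order of the edges around each vertex) such that every face, including the outer face, is bounded by a cycle of length $3$. If $xy$ is an edge of a triangulation $T$, $xya$ and $xyb$ are its two incident faces, $a\neq b$, and $ab$ is not an edge of $T$, then \emph{flipping} $xy$ means deleting $xy$ and adding the edge $ab$ inside the resulting quadrilateral, which again gives a triangulation. Let $n\ge 7$, and let $T_1$ and $T_2$ be any two triangulations with $n$ vertices each. Then there is a sequence of at most $8n-48$ edge flips that transforms $T_1$ into a triangulation isomorphic (as a graph) to $T_2$. If moreover $n\ge 13$, then there is such a sequence of at most $8n-54$ edge flips. -/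

import Mathlib

/-- A combinatorial embedding of a simple graph: around every vertex `v` the neighbours of `v`
are arranged in one cyclic (clockwise) order, recorded by the permutation `rot v`, which sends a
neighbour of `v` to the next one and fixes every vertex that is not a neighbour of `v`. -/
structure EmbeddedGraph (V : Type*) where
  graph : SimpleGraph V
  rot : V → Equiv.Perm V
  rot_isCycleOn : ∀ v, (rot v).IsCycleOn (graph.neighborSet v)
  rot_eq_self : ∀ v w, ¬ graph.Adj v w → rot v w = w

namespace EmbeddedGraph

variable {V : Type*} (G : EmbeddedGraph V)

theorem adj_rot {u v : V} (h : G.graph.Adj u v) : G.graph.Adj v (G.rot v u) :=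
  (G.rot_isCycleOn v).1.mapsTo h.symm

/-- One step of the walk around a face: after the directed edge `(u, v)` comes the directed edge
that leaves `v` towards the neighbour following `u` in the cyclic order around `v`. -/
def faceNext (d : G.graph.Dart) : G.graph.Dart :=
  ⟨(d.snd, G.rot d.snd d.fst), G.adj_rot d.adj⟩

/-- The face of a directed edge: all directed edges met on the walk that starts with it. -/
def face (d : G.graph.Dart) : Set G.graph.Dart :=
  {e | ∃ k : ℕ, G.faceNext^[k] d = e}

/-- The faces, the outer face included, each one given as the set of its directed edges. -/
def faces : Set (Set G.graph.Dart) := Set.range G.face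

/-- The combinatorial embedding is an embedding of a connected graph in the plane (equivalently,
in the sphere): the surface that it describes has Euler characteristic 2. -/
def IsPlane : Prop :=
  G.graph.Connected ∧ Nat.card V + G.faces.ncard = G.graph.edgeSet.ncard + 2

end EmbeddedGraph

/-- A (combinatorial) triangulation with vertex set `V`: a simple graph with a combinatorial
embedding in the plane such that every face, the outer face included, is a cycle of length 3. (A
facial walk of length 3 in a simple graph is always a cycle.) -/
structure Triangulation (V : Type*) extends EmbeddedGraph V where
  isPlane : toEmbeddedGraph.IsPlane
  ncard_face : ∀ f ∈ toEmbeddedGraph.faces, f.ncard = 3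

/-- Remove `w` from the cyclic order `σ`: its predecessor is now followed by its successor. -/
def cyclicErase {V : Type*} [DecidableEq V] (σ : Equiv.Perm V) (w : V) : Equiv.Perm V :=
  Equiv.swap w (σ w) * σ

/-- Insert `w`, a fixed point of `σ`, into the cyclic order `σ` immediately after `u`. -/
def cyclicInsertAfter {V : Type*} [DecidableEq V] (σ : Equiv.Perm V) (u w : V) : Equiv.Perm V :=
  Equiv.swap w (σ u) * σ

namespace Triangulation

open Classical in
/-- `T'` arises from `T` by one edge flip. The edge `xy` lies on the faces `x → y → a` and
`y → x → b`, and `ab` is not an edge; `xy` is deleted and `ab` is added inside the quadrilateral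
`x b y a`. All cyclic orders stay the same except for this deletion and insertion. -/
def IsFlip {V : Type*} (T T' : Triangulation V) : Prop :=
  ∃ x y a b : V, T.graph.Adj x y ∧ a = T.rot y x ∧ b = T.rot x y ∧
    a ≠ b ∧ ¬ T.graph.Adj a b ∧
    T'.graph = T.graph.deleteEdges {s(x, y)} ⊔ SimpleGraph.edge a b ∧
    T'.rot x = cyclicErase (T.rot x) y ∧
    T'.rot y = cyclicErase (T.rot y) x ∧
    T'.rot a = cyclicInsertAfter (T.rot a) y b ∧
    T'.rot b = cyclicInsertAfter (T.rot b) x a ∧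
    ∀ v, v ≠ x → v ≠ y → v ≠ a → v ≠ b → T'.rot v = T.rot v

/-- `FlipSequence k T T'`: a sequence of exactly `k` edge flips leads from `T` to `T'`. -/
inductive FlipSequence {V : Type*} : ℕ → Triangulation V → Triangulation V → Prop
  | refl (T : Triangulation V) : FlipSequence 0 T T
  | step {k : ℕ} {T T' T'' : Triangulation V} :
      FlipSequence k T T' → IsFlip T' T'' → FlipSequence (k + 1) T T''

/-- `T` can be transformed by at most `m` edge flips into a triangulation isomorphic to `T'`. -/
def TransformableWithin {V W : Type*} (m : ℕ) (T : Triangulation V) (T' : Triangulation W) :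
    Prop :=
  ∃ k ≤ m, ∃ S : Triangulation V, FlipSequence k T S ∧ Nonempty (S.graph ≃g T'.graph)

end Triangulation

open Function

/-! Flips are reversible, and all fans with `n` vertices (a path joined to two adjacent vertices
`x`, `y`) are isomorphic as embedded graphs. So it is enough to flip each triangulation to a fan in
at most `4n - 24` flips, or `4n - 27` for `n ≥ 13`, and to run one of the two sequences backwards.

The cost is controlled by the potential `3 deg x + deg y` of an edge `xy`, which never exceeds `4(n
- 1)`. Unless the triangulation is already a fan about `xy`, one or two flips keep `xy` and raise
the potential by at least their number (`isFan_or_exists_flipSequence`): either one flip raises `deg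
y`, or at most two flips raise `deg x` by one while `deg y` drops by one, a gain of `3 - 1 = 2`.
Hence `4n - 4 - 3 deg x - deg y` flips suffice. One of these flips is legal only because crossing
chords of the link of a vertex cannot both be edges; this planarity fact is derived from the
vanishing of first homology modulo 2, a consequence of Euler's formula.

It remains to start from an edge of large potential. The average degree `6 - 12/n` gives a vertex
`x` of degree at least 5, or 6 if `n ≥ 13`. A neighbour of degree at least 5 makes the potential at
least 20, respectively 23. Without such a neighbour the triangulation is a bipyramid over the link
of `x` (`exists_apex`), which is treated directly. -/

instance SimpleGraph.Dart.instFinite {V : Type*} [Finite V] (G : SimpleGraph V) : Finite G.Dart :=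
  Finite.of_injective _ SimpleGraph.Dart.toProd_injective

/-- Iterating `σ` from one point of the cycle reaches every other. Applied to rotations, this
determines a neighbourhood: a collection containing one neighbour and closed under rotation contains
all of them. -/
theorem Equiv.Perm.IsCycleOn.induction {V : Type*} [Finite V] {σ : Equiv.Perm V} {s : Set V}
    (hσ : σ.IsCycleOn s) {a b : V} {p : V → Prop} (ha : a ∈ s) (hp : p a)
    (h : ∀ t ∈ s, p t → p (σ t)) (hb : b ∈ s) : p b := by
  obtain ⟨k, -, rfl⟩ := (hσ.2 ha hb).exists_pow_eq'
  have : ∀ k : ℕ, (σ ^ k) a ∈ s ∧ p ((σ ^ k) a) := by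
    intro k
    induction k with
    | zero => exact ⟨ha, hp⟩
    | succ k ih =>
      rw [pow_succ', Equiv.Perm.mul_apply]
      exact ⟨hσ.1.mapsTo ih.1, h _ ih.1 ih.2⟩
  exact (this k).2

/-! ### Face walks and edge counts of embeddings with triangular faces -/

namespace EmbeddedGraph

variable {V : Type*} (G : EmbeddedGraph V)

/-- The directed edge `(u, v)` is followed on its face by the directed edge `(v, w)`. -/
def Turn (u v w : V) : Prop := G.graph.Adj u v ∧ G.rot v u = w

/-- The walk around every face closes up after three steps. -/
def IsTriangular : Prop := ∀ u v w, G.Turn u v w → G.Turn v w u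

/-- The degree of a vertex. -/
noncomputable def deg (v : V) : ℕ := (G.graph.neighborSet v).ncard

theorem ext_rot {G H : EmbeddedGraph V} (hg : G.graph = H.graph) (hr : ∀ v, G.rot v = H.rot v) :
    G = H := by
  cases G; cases H
  obtain rfl := hg
  obtain rfl : _ = _ := funext hr
  rfl

theorem faceNext_injective : Injective G.faceNext := by
  rintro ⟨⟨a, b⟩, h⟩ ⟨⟨c, d⟩, h'⟩ e
  simp only [faceNext, SimpleGraph.Dart.mk.injEq, Prod.mk.injEq] at e
  obtain ⟨rfl, e⟩ := e
  simpa using e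

theorem face_eq_image [Finite V] (d : G.graph.Dart) :
    G.face d = (fun k => G.faceNext^[k] d) '' Set.Iio (minimalPeriod G.faceNext d) := by
  have hp : d ∈ periodicPts G.faceNext := G.faceNext_injective.mem_periodicPts d
  ext e
  constructor
  · rintro ⟨k, rfl⟩
    exact ⟨k % minimalPeriod G.faceNext d, Nat.mod_lt _ (minimalPeriod_pos_of_mem_periodicPts hp),
      iterate_mod_minimalPeriod_eq⟩
  · rintro ⟨k, -, rfl⟩
    exact ⟨k, rfl⟩

theorem ncard_face_eq_minimalPeriod [Finite V] (d : G.graph.Dart) :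
    (G.face d).ncard = minimalPeriod G.faceNext d := by
  rw [face_eq_image, Set.InjOn.ncard_image iterate_injOn_Iio_minimalPeriod]
  simp [Set.ncard_eq_toFinset_card']

theorem isTriangular_of_ncard_face [Finite V] (h : ∀ f ∈ G.faces, f.ncard = 3) :
    G.IsTriangular := by
  rintro u v w ⟨huv, rfl⟩
  have h3 := h _ ⟨⟨(u, v), huv⟩, rfl⟩
  rw [ncard_face_eq_minimalPeriod] at h3
  have := isPeriodicPt_minimalPeriod G.faceNext ⟨(u, v), huv⟩
  rw [h3] at this
  have := congrArg (fun d : G.graph.Dart => d.toProd) this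
  simp only [iterate_succ, iterate_zero, comp_apply, faceNext, id_eq, Prod.mk.injEq] at this
  exact ⟨G.adj_rot huv, this.1⟩

theorem face_faceNext [Finite V] (d : G.graph.Dart) : G.face (G.faceNext d) = G.face d := by
  ext e
  constructor
  · rintro ⟨k, rfl⟩
    exact ⟨k + 1, rfl⟩
  · rintro ⟨k, rfl⟩
    obtain ⟨m, hm, hd⟩ := G.faceNext_injective.mem_periodicPts d
    refine ⟨k + (m - 1), ?_⟩
    rw [← iterate_succ_apply, show (k + (m - 1)).succ = k + m by omega, iterate_add_apply, hd]

theorem face_eq_of_mem [Finite V] {d e : G.graph.Dart} (h : e ∈ G.face d) :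
    G.face e = G.face d := by
  obtain ⟨k, rfl⟩ := h
  induction k with
  | zero => rfl
  | succ k ih => rw [iterate_succ_apply', face_faceNext, ih]

variable {G}

theorem IsTriangular.ncard_face [Finite V] (h : G.IsTriangular) :
    ∀ f ∈ G.faces, f.ncard = 3 := by
  rintro _ ⟨⟨⟨u, v⟩, huv⟩, rfl⟩
  rw [ncard_face_eq_minimalPeriod]
  have h1 : G.Turn u v _ := ⟨huv, rfl⟩
  have h2 := h _ _ _ h1
  have h3 := h _ _ _ h2
  -- The period divides the prime 3, and it is not 1 because the two ends of an edge differ.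
  have : Fact (Nat.Prime 3) := ⟨Nat.prime_three⟩
  refine minimalPeriod_eq_prime ?_ ?_
  rotate_left
  · intro e
    have := congrArg (fun d : G.graph.Dart => d.fst) e
    exact huv.ne this.symm
  · refine SimpleGraph.Dart.ext _ _ ?_
    simp only [iterate_succ, iterate_zero, comp_apply, faceNext, id_eq, Prod.mk.injEq]
    rw [h2.2]
    exact ⟨rfl, h3.2⟩

theorem card_dart [Finite V] : Nat.card G.graph.Dart = 2 * G.graph.edgeSet.ncard := by
  classical
  have := Fintype.ofFinite V
  rw [Nat.card_eq_fintype_card, G.graph.dart_card_eq_twice_card_edges,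
    Set.ncard_eq_toFinset_card', SimpleGraph.edgeFinset]

theorem IsTriangular.three_mul_ncard_faces [Finite V] (h : G.IsTriangular) :
    3 * G.faces.ncard = 2 * G.graph.edgeSet.ncard := by
  classical
  have := Fintype.ofFinite V
  have := Fintype.ofFinite G.graph.Dart
  rw [← card_dart, Nat.card_eq_fintype_card, ← Finset.card_univ,
    Finset.card_eq_sum_card_fiberwise (f := G.face) (t := G.faces.toFinset) (by
      intro d _; simpa [-Set.toFinset_range] using ⟨d, rfl⟩)]
  rw [Finset.sum_const_nat (m := 3), Set.ncard_eq_toFinset_card', mul_comm]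
  intro f hf
  rw [Set.mem_toFinset] at hf
  rw [← h.ncard_face f hf, ← Set.ncard_coe_finset]
  congr 1
  ext e
  obtain ⟨d, rfl⟩ := hf
  simp only [Finset.coe_filter, Finset.mem_univ, true_and, Set.mem_ofPred_eq]
  exact ⟨fun h => h ▸ ⟨0, rfl⟩, G.face_eq_of_mem⟩

/-- A connected embedded graph with triangular faces and `3n - 6` edges is a triangulation. -/
def IsTriangular.triangulation [Finite V] (h : G.IsTriangular) (hc : G.graph.Connected)
    (he : G.graph.edgeSet.ncard + 6 = 3 * Nat.card V) : Triangulation V where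
  toEmbeddedGraph := G
  isPlane := ⟨hc, by have := h.three_mul_ncard_faces; omega⟩
  ncard_face := h.ncard_face

theorem rot_induction [Finite V] {v u w : V} {p : V → Prop} (hu : G.graph.Adj v u) (hp : p u)
    (h : ∀ t, G.graph.Adj v t → p t → p (G.rot v t)) (hw : G.graph.Adj v w) : p w :=
  (G.rot_isCycleOn v).induction hu hp h hw

end EmbeddedGraph

/-! ### Oriented faces and degrees in a triangulation -/

namespace Triangulation

variable {V : Type*} {T : Triangulation V}

theorem ext_rot {T S : Triangulation V} (hg : T.graph = S.graph) (hr : ∀ v, T.rot v = S.rot v) :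
    T = S := by
  have := EmbeddedGraph.ext_rot hg hr
  cases T; cases S
  simpa using this

variable [Finite V]

theorem isTriangular (T : Triangulation V) : T.IsTriangular :=
  T.isTriangular_of_ncard_face T.ncard_face

theorem ncard_edgeSet (T : Triangulation V) :
    T.graph.edgeSet.ncard + 6 = 3 * Nat.card V := by
  have := T.isTriangular.three_mul_ncard_faces
  have := T.isPlane.2
  omega

omit [Finite V] in
theorem connected (T : Triangulation V) : T.graph.Connected := T.isPlane.1

end Triangulation

namespace EmbeddedGraph.Turn

variable {V : Type*} [Finite V] {T : Triangulation V} {u v w : V}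

theorem next (h : T.Turn u v w) : T.Turn v w u := T.isTriangular _ _ _ h

theorem prev (h : T.Turn u v w) : T.Turn w u v := h.next.next

omit [Finite V] in
theorem adj₁₂ (h : T.Turn u v w) : T.graph.Adj u v := h.1

theorem adj₂₃ (h : T.Turn u v w) : T.graph.Adj v w := h.next.1

theorem adj₃₁ (h : T.Turn u v w) : T.graph.Adj w u := h.prev.1

theorem rot₁ (h : T.Turn u v w) : T.rot u w = v := h.prev.2

omit [Finite V] in
theorem rot₂ (h : T.Turn u v w) : T.rot v u = w := h.2

theorem rot₃ (h : T.Turn u v w) : T.rot w v = u := h.next.2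

theorem eq₁ {u' : V} (h : T.Turn u v w) (h' : T.Turn u' v w) : u = u' :=
  h.rot₃.symm.trans h'.rot₃

theorem eq₂ {v' : V} (h : T.Turn u v w) (h' : T.Turn u v' w) : v = v' :=
  h.rot₁.symm.trans h'.rot₁

omit [Finite V] in
theorem eq₃ {w' : V} (h : T.Turn u v w) (h' : T.Turn u v w') : w = w' :=
  h.rot₂.symm.trans h'.rot₂

end EmbeddedGraph.Turn

namespace Triangulation

variable {V : Type*} [Finite V] (T : Triangulation V)

omit [Finite V] in
theorem turn_of_adj {u v : V} (h : T.graph.Adj u v) : T.Turn u v (T.rot v u) := ⟨h, rfl⟩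

omit [Finite V] in
theorem exists_turn {u v : V} (h : T.graph.Adj u v) : ∃ w, T.Turn u v w := ⟨_, h, rfl⟩

/-- The degrees sum to `6n - 12`, so they cannot all be at most `c` when `cn < 6n - 12`. -/
theorem exists_deg_gt {c : ℕ} (h : c * Nat.card V + 12 < 6 * Nat.card V) : ∃ v, c < T.deg v := by
  classical
  have := Fintype.ofFinite V
  by_contra! hc
  have h1 := T.graph.sum_degrees_eq_twice_card_edges
  have h2 : ∑ v, T.graph.degree v ≤ ∑ _v : V, c := Finset.sum_le_sum fun v _ => by
    have := hc v
    rwa [EmbeddedGraph.deg, Set.ncard_eq_toFinset_card'] at this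
  have h3 := T.ncard_edgeSet
  rw [Set.ncard_eq_toFinset_card', ← SimpleGraph.edgeFinset] at h3
  rw [Finset.sum_const, smul_eq_mul, Finset.card_univ, ← Nat.card_eq_fintype_card, mul_comm] at h2
  omega

theorem deg_lt (v : V) : T.deg v < Nat.card V := by
  rw [EmbeddedGraph.deg, ← Set.ncard_univ]
  refine Set.ncard_lt_ncard ⟨Set.subset_univ _, fun h => ?_⟩
  exact T.graph.irrefl (h (Set.mem_univ v))

theorem two_le_deg {u v : V} (h : T.graph.Adj u v) : 2 ≤ T.deg u := by
  have ht := T.turn_of_adj h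
  have : ({v, T.rot v u} : Set V).ncard = 2 := Set.ncard_pair ht.adj₂₃.ne
  rw [← this]
  refine Set.ncard_le_ncard ?_
  rintro w (rfl | rfl)
  · exact h
  · exact ht.adj₃₁.symm

end Triangulation

/-! ### Deletion and insertion in a cyclic order -/

section CyclicOrder

variable {V : Type*} [DecidableEq V] {σ : Equiv.Perm V} {s : Set V} {u w t : V}

theorem cyclicErase_apply_self : cyclicErase σ w w = w := by
  simp [cyclicErase]

theorem cyclicErase_apply_pred (h : σ t = w) : cyclicErase σ w t = σ w := by
  simp [cyclicErase, h]

theorem cyclicErase_apply_of_ne (ht : t ≠ w) (h : σ t ≠ w) : cyclicErase σ w t = σ t := by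
  simp [cyclicErase, Equiv.swap_apply_of_ne_of_ne h (σ.injective.ne ht)]

theorem cyclicErase_apply_of_fixed (h : σ t = t) : cyclicErase σ w t = t := by
  by_cases ht : t = w
  · subst ht; exact cyclicErase_apply_self
  · rw [cyclicErase_apply_of_ne ht (by rwa [h]), h]

theorem cyclicInsertAfter_apply_left : cyclicInsertAfter σ u w u = w := by
  simp [cyclicInsertAfter]

theorem cyclicInsertAfter_apply_right (hw : σ w = w) : cyclicInsertAfter σ u w w = σ u := by
  simp [cyclicInsertAfter, hw]

theorem cyclicInsertAfter_apply_of_ne (hw : σ w = w) (h : t ≠ u) (ht : t ≠ w) :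
    cyclicInsertAfter σ u w t = σ t := by
  have : σ t ≠ w := fun e => ht (σ.injective (e.trans hw.symm))
  simp [cyclicInsertAfter, Equiv.swap_apply_of_ne_of_ne this (σ.injective.ne h)]

theorem cyclicErase_cyclicInsertAfter (hw : σ w = w) :
    cyclicErase (cyclicInsertAfter σ u w) w = σ := by
  rw [cyclicErase, cyclicInsertAfter_apply_right hw, cyclicInsertAfter, ← mul_assoc,
    Equiv.swap_mul_self, one_mul]

theorem cyclicInsertAfter_cyclicErase (hu : σ u = w) :
    cyclicInsertAfter (cyclicErase σ w) u w = σ := by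
  rw [cyclicInsertAfter, cyclicErase_apply_pred hu, cyclicErase, ← mul_assoc,
    Equiv.swap_mul_self, one_mul]

omit [DecidableEq V] in
theorem isCycleOn_of_mapsTo [Finite V] (h : Set.MapsTo σ s s)
    (h' : ∀ a ∈ s, ∀ b ∈ s, σ.SameCycle a b) : σ.IsCycleOn s :=
  ⟨(s.toFinite.injOn_iff_bijOn_of_mapsTo h).1 σ.injective.injOn, fun a ha b hb => h' a ha b hb⟩

theorem isCycleOn_cyclicErase [Finite V] (h : σ.IsCycleOn s) :
    (cyclicErase σ w).IsCycleOn (s \ {w}) := by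
  refine isCycleOn_of_mapsTo ?_ ?_
  · rintro t ⟨ht, htw : t ≠ w⟩
    by_cases e : σ t = w
    · rw [cyclicErase_apply_pred e]
      refine ⟨h.1.mapsTo (e ▸ h.1.mapsTo ht), fun e' : σ w = w => htw (σ.injective ?_)⟩
      rw [e, e']
    · rw [cyclicErase_apply_of_ne htw e]
      exact ⟨h.1.mapsTo ht, e⟩
  · rintro a ⟨ha, haw : a ≠ w⟩ b ⟨hb, hbw : b ≠ w⟩
    -- The walk along `σ` may pass through the erased point `w`; there the claim is carried by its
    -- successor `σ w`.
    have := h.induction (a := a) (b := b)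
      (p := fun t => (t ≠ w → (cyclicErase σ w).SameCycle a t) ∧
        (t = w → (cyclicErase σ w).SameCycle a (σ w))) ha
      ⟨fun _ => .rfl, fun e => absurd e haw⟩ ?_ hb
    · exact this.1 hbw
    · rintro t - ⟨h1, h2⟩
      by_cases ht : t = w
      · subst ht
        exact ⟨fun _ => h2 rfl, fun _ => h2 rfl⟩
      · refine ⟨fun e => ?_, fun e => ?_⟩
        · rw [← cyclicErase_apply_of_ne ht e, Equiv.Perm.sameCycle_apply_right]
          exact h1 ht
        · rw [← cyclicErase_apply_pred e, Equiv.Perm.sameCycle_apply_right]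
          exact h1 ht

theorem isCycleOn_cyclicInsertAfter [Finite V] (h : σ.IsCycleOn s) (hu : u ∈ s) (hw : w ∉ s)
    (hσ : σ w = w) : (cyclicInsertAfter σ u w).IsCycleOn (insert w s) := by
  have key : ∀ t ∈ insert w s, (cyclicInsertAfter σ u w).SameCycle u t := by
    have h1 : (cyclicInsertAfter σ u w).SameCycle u w := by
      conv_rhs => rw [← cyclicInsertAfter_apply_left (σ := σ) (u := u) (w := w)]
      rw [Equiv.Perm.sameCycle_apply_right]
    rintro t (rfl | ht)
    · exact h1
    · refine h.induction (p := fun t => (cyclicInsertAfter σ u w).SameCycle u t) hu .rfl ?_ ht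
      intro t ht h2
      by_cases e : t = u
      · subst e
        rwa [← cyclicInsertAfter_apply_right hσ, Equiv.Perm.sameCycle_apply_right]
      · rwa [← cyclicInsertAfter_apply_of_ne hσ e (by rintro rfl; exact hw ht),
          Equiv.Perm.sameCycle_apply_right]
  refine isCycleOn_of_mapsTo ?_ fun a ha b hb => (key a ha).symm.trans (key b hb)
  rintro t (rfl | ht)
  · rw [cyclicInsertAfter_apply_right hσ]
    exact .inr (h.1.mapsTo hu)
  · by_cases e : t = u
    · subst e
      rw [cyclicInsertAfter_apply_left]
      exact .inl rfl
    · rw [cyclicInsertAfter_apply_of_ne hσ e (by rintro rfl; exact hw ht)]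
      exact .inr (h.1.mapsTo ht)

end CyclicOrder

/-! ### A flip yields a triangulation and can be undone -/

namespace Triangulation

variable {V : Type*}

theorem flip_adj {T : Triangulation V} {x y a b v w : V} (hab : a ≠ b) :
    (T.graph.deleteEdges {s(x, y)} ⊔ SimpleGraph.edge a b).Adj v w ↔
      (T.graph.Adj v w ∧ s(v, w) ≠ s(x, y)) ∨ s(v, w) = s(a, b) := by
  rw [SimpleGraph.sup_adj, SimpleGraph.deleteEdges_adj, SimpleGraph.edge_adj, Sym2.eq_iff,
    Set.mem_singleton_iff]
  grind

open Classical in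
/-- The embedded graph `H` arises from `T` by flipping the edge `xy` to `ab`. -/
structure IsFlipAt (T : Triangulation V) (H : EmbeddedGraph V) (x y a b : V) : Prop where
  turn₁ : T.Turn x y a
  turn₂ : T.Turn y x b
  ne : a ≠ b
  not_adj : ¬ T.graph.Adj a b
  graph_eq : H.graph = T.graph.deleteEdges {s(x, y)} ⊔ SimpleGraph.edge a b
  rot₁ : H.rot x = cyclicErase (T.rot x) y
  rot₂ : H.rot y = cyclicErase (T.rot y) x
  rot₃ : H.rot a = cyclicInsertAfter (T.rot a) y b
  rot₄ : H.rot b = cyclicInsertAfter (T.rot b) x a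
  rot_of_ne : ∀ v, v ≠ x → v ≠ y → v ≠ a → v ≠ b → H.rot v = T.rot v

theorem isFlip_iff {T T' : Triangulation V} :
    IsFlip T T' ↔ ∃ x y a b, IsFlipAt T T'.toEmbeddedGraph x y a b := by
  constructor
  · rintro ⟨x, y, a, b, h1, h2, h3, h4, h5, h6, h7, h8, h9, h10, h11⟩
    exact ⟨x, y, a, b, ⟨h1, h2.symm⟩, ⟨h1.symm, h3.symm⟩, h4, h5, h6, h7, h8, h9, h10, h11⟩
  · rintro ⟨x, y, a, b, h⟩
    exact ⟨x, y, a, b, h.turn₁.1, h.turn₁.2.symm, h.turn₂.2.symm, h.ne, h.not_adj, h.graph_eq,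
      h.rot₁, h.rot₂, h.rot₃, h.rot₄, h.rot_of_ne⟩

variable [Finite V] {T : Triangulation V} {x y a b : V}

/-- The flip of `xy` to `ab`, as an embedded graph. -/
noncomputable def flipGraph (h₁ : T.Turn x y a)
    (h₂ : T.Turn y x b) (hab : a ≠ b) (hn : ¬ T.graph.Adj a b) : EmbeddedGraph V :=
  open Classical in
  have hx := h₁.adj₁₂.ne
  have hy := h₁.adj₂₃.ne
  have ha := h₁.adj₃₁.ne
  have hb := h₂.adj₂₃.ne
  have hb' := h₂.adj₃₁.ne
  { graph := T.graph.deleteEdges {s(x, y)} ⊔ SimpleGraph.edge a b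
    rot := fun v =>
      if v = x then cyclicErase (T.rot x) y
      else if v = y then cyclicErase (T.rot y) x
      else if v = a then cyclicInsertAfter (T.rot a) y b
      else if v = b then cyclicInsertAfter (T.rot b) x a
      else T.rot v
    rot_isCycleOn := by
      have hfa := T.rot_eq_self a b hn
      have hfb := T.rot_eq_self b a fun h => hn h.symm
      intro v
      split_ifs with e1 e2 e3 e4
      · convert isCycleOn_cyclicErase (w := y) (T.rot_isCycleOn x) using 1
        ext w
        rw [SimpleGraph.mem_neighborSet, flip_adj hab]
        simp only [Set.mem_sdiff, SimpleGraph.mem_neighborSet, Set.mem_singleton_iff, Sym2.eq_iff]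
        grind
      · convert isCycleOn_cyclicErase (w := x) (T.rot_isCycleOn y) using 1
        ext w
        rw [SimpleGraph.mem_neighborSet, flip_adj hab]
        simp only [Set.mem_sdiff, SimpleGraph.mem_neighborSet, Set.mem_singleton_iff, Sym2.eq_iff]
        grind
      · convert isCycleOn_cyclicInsertAfter (T.rot_isCycleOn a) h₁.adj₂₃.symm hn hfa using 1
        ext w
        rw [SimpleGraph.mem_neighborSet, flip_adj hab]
        simp only [Set.mem_insert_iff, SimpleGraph.mem_neighborSet, Sym2.eq_iff]
        grind
      · convert isCycleOn_cyclicInsertAfter (T.rot_isCycleOn b) h₂.adj₂₃.symm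
          (fun h => hn h.symm) hfb using 1
        ext w
        rw [SimpleGraph.mem_neighborSet, flip_adj hab]
        simp only [Set.mem_insert_iff, SimpleGraph.mem_neighborSet, Sym2.eq_iff]
        grind
      · convert T.rot_isCycleOn v using 1
        ext w
        rw [SimpleGraph.mem_neighborSet, flip_adj hab]
        simp only [SimpleGraph.mem_neighborSet, Sym2.eq_iff]
        grind
    rot_eq_self := by
      have hfa := T.rot_eq_self a b hn
      have hfb := T.rot_eq_self b a fun h => hn h.symm
      intro v w hvw
      rw [flip_adj hab, not_or, not_and_not_right, Sym2.eq_iff, Sym2.eq_iff] at hvw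
      classical
      split_ifs with e1 e2 e3 e4
      · by_cases e : w = y
        · subst e; exact cyclicErase_apply_self
        · exact cyclicErase_apply_of_fixed (T.rot_eq_self _ _ (by grind))
      · by_cases e : w = x
        · subst e; exact cyclicErase_apply_self
        · exact cyclicErase_apply_of_fixed (T.rot_eq_self _ _ (by grind))
      · have h3 := h₁.adj₂₃.symm
        have h : ¬ T.graph.Adj a w := by grind
        rw [cyclicInsertAfter_apply_of_ne hfa (by rintro rfl; exact h h3) (by grind),
          T.rot_eq_self _ _ h]
      · have h3 := h₂.adj₂₃.symm
        have h : ¬ T.graph.Adj b w := by grind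
        rw [cyclicInsertAfter_apply_of_ne hfb (by rintro rfl; exact h h3) (by grind),
          T.rot_eq_self _ _ h]
      · exact T.rot_eq_self _ _ (by grind) }

theorem isFlipAt_flipGraph (h₁ : T.Turn x y a)
    (h₂ : T.Turn y x b) (hab : a ≠ b) (hn : ¬ T.graph.Adj a b) :
    IsFlipAt T (flipGraph h₁ h₂ hab hn) x y a b := by
  have hx := h₁.adj₁₂.ne
  have hy := h₁.adj₂₃.ne
  have ha := h₁.adj₃₁.ne
  have hb := h₂.adj₂₃.ne
  have hb' := h₂.adj₃₁.ne
  refine ⟨h₁, h₂, hab, hn, rfl, ?_, ?_, ?_, ?_, ?_⟩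
  · simp [flipGraph]
  · simp [flipGraph, hx.symm]
  · simp [flipGraph, hy.symm, ha]
  · simp [flipGraph, hb.symm, hb', hab.symm]
  · intro v h1 h2 h3 h4
    simp [flipGraph, h1, h2, h3, h4]

namespace IsFlipAt

variable {H : EmbeddedGraph V}

omit [Finite V] in
theorem adj_iff (h : IsFlipAt T H x y a b) {v w : V} : H.graph.Adj v w ↔
    (T.graph.Adj v w ∧ s(v, w) ≠ s(x, y)) ∨ s(v, w) = s(a, b) := by
  rw [h.graph_eq, flip_adj h.ne]

omit [Finite V] in
theorem rot_not_adj (h : IsFlipAt T H x y a b) : T.rot a b = b ∧ T.rot b a = a :=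
  ⟨T.rot_eq_self a b h.not_adj, T.rot_eq_self b a fun e => h.not_adj e.symm⟩

theorem new_turns (h : IsFlipAt T H x y a b) :
    (H.Turn a b y ∧ H.Turn b y a ∧ H.Turn y a b) ∧
      (H.Turn b a x ∧ H.Turn a x b ∧ H.Turn x b a) := by
  classical
  have h₁ := h.turn₁
  have h₂ := h.turn₂
  have hx := h₁.adj₁₂.ne
  have hy := h₁.adj₂₃.ne
  have ha := h₁.adj₃₁.ne
  have hb := h₂.adj₂₃.ne
  have hb' := h₂.adj₃₁.ne
  have hne := h.ne
  have hr := h.rot_not_adj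
  simp only [EmbeddedGraph.Turn, h.adj_iff, ne_eq, Sym2.eq_iff, h.rot₁, h.rot₂, h.rot₃, h.rot₄]
  rw [cyclicErase_apply_pred h₁.rot₁, cyclicErase_apply_pred h₂.rot₁,
    cyclicInsertAfter_apply_left, cyclicInsertAfter_apply_left,
    cyclicInsertAfter_apply_right hr.1, cyclicInsertAfter_apply_right hr.2, h₁.rot₃, h₂.rot₃,
    h₁.rot₂, h₂.rot₂]
  have := h₁.adj₂₃
  have := h₁.adj₃₁
  have := h₂.adj₂₃
  have := h₂.adj₃₁
  grind

/-- The excluded pairs are the six directed edges of the two faces that meet in `xy`; only there is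
the successor altered. -/
theorem rot_eq (h : IsFlipAt T H x y a b) {u v : V} (hadj : T.graph.Adj u v)
    (h1 : (u, v) ≠ (x, y)) (h2 : (u, v) ≠ (y, a)) (h3 : (u, v) ≠ (a, x))
    (h4 : (u, v) ≠ (y, x)) (h5 : (u, v) ≠ (x, b)) (h6 : (u, v) ≠ (b, y)) :
    H.rot v u = T.rot v u := by
  classical
  have hr := h.rot_not_adj
  have hn := h.not_adj
  have hn' : ¬ T.graph.Adj b a := fun e => hn e.symm
  simp only [ne_eq, Prod.mk.injEq, not_and] at h1 h2 h3 h4 h5 h6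
  by_cases e1 : v = x
  · subst e1
    rw [h.rot₁, cyclicErase_apply_of_ne (by grind)]
    intro e
    exact h3 ((T.rot v).injective (e.trans h.turn₁.rot₁.symm)) rfl
  by_cases e2 : v = y
  · subst e2
    rw [h.rot₂, cyclicErase_apply_of_ne (by grind)]
    intro e
    exact h6 ((T.rot v).injective (e.trans h.turn₂.rot₁.symm)) rfl
  by_cases e3 : v = a
  · subst e3
    rw [h.rot₃, cyclicInsertAfter_apply_of_ne hr.1 (by grind) (by grind)]
  by_cases e4 : v = b
  · subst e4
    rw [h.rot₄, cyclicInsertAfter_apply_of_ne hr.2 (by grind) (by grind)]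
  rw [h.rot_of_ne v e1 e2 e3 e4]

theorem turn_of_turn (h : IsFlipAt T H x y a b) {u v w : V} (ht : T.Turn u v w)
    (h1 : s(u, v) ≠ s(x, y)) (h2 : s(v, w) ≠ s(x, y)) (h3 : s(w, u) ≠ s(x, y)) :
    H.Turn u v w := by
  refine ⟨h.adj_iff.2 (.inl ⟨ht.1, h1⟩), ?_⟩
  rw [← ht.2]
  have := h.turn₁
  have := h.turn₂
  simp only [ne_eq, Sym2.eq_iff] at h1 h2 h3
  refine h.rot_eq ht.1 ?_ ?_ ?_ ?_ ?_ ?_ <;> intro e <;> rw [Prod.mk.injEq] at e <;>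
    obtain ⟨rfl, rfl⟩ := e
  · grind
  · have := ht.eq₃ h.turn₁.next
    grind
  · have := ht.eq₃ h.turn₁.prev
    grind
  · grind
  · have := ht.eq₃ h.turn₂.next
    grind
  · have := ht.eq₃ h.turn₂.prev
    grind

theorem isTriangular (h : IsFlipAt T H x y a b) : H.IsTriangular := by
  intro u v w ht
  obtain ⟨⟨n1, n2, n3⟩, n4, n5, n6⟩ := h.new_turns
  -- Six directed edges bound the two new faces. Any other one is an old edge whose face avoids
  -- `xy`, and that face survives.
  by_cases e1 : (u, v) = (a, b)
  · rw [Prod.mk.injEq] at e1; obtain ⟨rfl, rfl⟩ := e1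
    rwa [← ht.2, n1.2]
  by_cases e2 : (u, v) = (b, y)
  · rw [Prod.mk.injEq] at e2; obtain ⟨rfl, rfl⟩ := e2
    rwa [← ht.2, n2.2]
  by_cases e3 : (u, v) = (y, a)
  · rw [Prod.mk.injEq] at e3; obtain ⟨rfl, rfl⟩ := e3
    rwa [← ht.2, n3.2]
  by_cases e4 : (u, v) = (b, a)
  · rw [Prod.mk.injEq] at e4; obtain ⟨rfl, rfl⟩ := e4
    rwa [← ht.2, n4.2]
  by_cases e5 : (u, v) = (a, x)
  · rw [Prod.mk.injEq] at e5; obtain ⟨rfl, rfl⟩ := e5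
    rwa [← ht.2, n5.2]
  by_cases e6 : (u, v) = (x, b)
  · rw [Prod.mk.injEq] at e6; obtain ⟨rfl, rfl⟩ := e6
    rwa [← ht.2, n6.2]
  obtain ⟨hadj, hw⟩ := ht
  have hadj' := h.adj_iff.1 hadj
  rw [Sym2.eq_iff] at hadj'
  have hadj : T.graph.Adj u v ∧ s(u, v) ≠ s(x, y) := by grind
  have hs := hadj.2
  rw [ne_eq, Sym2.eq_iff] at hs
  rw [h.rot_eq hadj.1 (by grind) e3 e5 (by grind) e6 e2] at hw
  have ht : T.Turn u v w := ⟨hadj.1, hw⟩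
  have t1 := h.turn₁
  have t2 := h.turn₂
  refine h.turn_of_turn ht.next ?_ ?_ hadj.2
  · rw [ne_eq, Sym2.eq_iff]
    rintro (⟨rfl, rfl⟩ | ⟨rfl, rfl⟩)
    · have := ht.eq₁ t1.prev; grind
    · have := ht.eq₁ t2.prev; grind
  · rw [ne_eq, Sym2.eq_iff]
    rintro (⟨rfl, rfl⟩ | ⟨rfl, rfl⟩)
    · have := ht.eq₂ t1.next; grind
    · have := ht.eq₂ t2.next; grind

/-- The only lost edge `xy` is replaced by the path from `x` through `b` to `y`. -/
theorem connected (h : IsFlipAt T H x y a b) : H.graph.Connected := by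
  have key : ∀ u v, T.graph.Adj u v → H.graph.Reachable u v := by
    intro u v huv
    obtain ⟨⟨n1, n2, n3⟩, n4, n5, n6⟩ := h.new_turns
    have hxy : H.graph.Reachable x y := n6.1.reachable.trans n2.1.reachable
    by_cases e : s(u, v) = s(x, y)
    · rw [Sym2.eq_iff] at e
      rcases e with ⟨rfl, rfl⟩ | ⟨rfl, rfl⟩
      exacts [hxy, hxy.symm]
    · exact (h.adj_iff.2 (.inl ⟨huv, e⟩)).reachable
  have : Nonempty V := ⟨x⟩
  refine ⟨fun u v => ?_⟩
  obtain ⟨p⟩ := T.connected.preconnected u v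
  induction p with
  | nil => rfl
  | cons e _ ih => exact (key _ _ e).trans ih

theorem ncard_edgeSet (h : IsFlipAt T H x y a b) :
    H.graph.edgeSet.ncard + 6 = 3 * Nat.card V := by
  have : H.graph.edgeSet = insert s(a, b) (T.graph.edgeSet \ {s(x, y)}) := by
    ext e
    induction e with | _ v w
    rw [SimpleGraph.mem_edgeSet, h.adj_iff, Set.mem_insert_iff, Set.mem_sdiff,
      SimpleGraph.mem_edgeSet, Set.mem_singleton_iff, or_comm]
  rw [this, Set.ncard_insert_of_notMem, Set.ncard_sdiff_singleton_of_mem, ← T.ncard_edgeSet]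
  · have : 0 < T.graph.edgeSet.ncard := by
      rw [Set.ncard_pos]
      exact ⟨_, (T.graph.mem_edgeSet).2 h.turn₁.1⟩
    omega
  · exact h.turn₁.1
  · exact fun e => h.not_adj e.1

theorem deg₁ (h : IsFlipAt T H x y a b) : H.deg x + 1 = T.deg x := by
  have : H.graph.neighborSet x = T.graph.neighborSet x \ {y} := by
    have h1 := h.turn₁.adj₃₁.ne
    have h2 := h.turn₂.adj₂₃.ne
    ext w
    simp only [SimpleGraph.mem_neighborSet, h.adj_iff, Sym2.eq_iff, Set.mem_sdiff,
      Set.mem_singleton_iff]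
    grind
  rw [EmbeddedGraph.deg, this, EmbeddedGraph.deg]
  exact Set.ncard_sdiff_singleton_add_one h.turn₁.1

theorem deg₃ (h : IsFlipAt T H x y a b) : H.deg a = T.deg a + 1 := by
  have : H.graph.neighborSet a = insert b (T.graph.neighborSet a) := by
    have h1 := h.turn₁.adj₃₁.ne
    have h2 := h.turn₁.adj₂₃.ne
    ext w
    simp only [SimpleGraph.mem_neighborSet, h.adj_iff, Sym2.eq_iff, Set.mem_insert_iff]
    grind
  rw [EmbeddedGraph.deg, this, EmbeddedGraph.deg]
  exact Set.ncard_insert_of_notMem h.not_adj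

omit [Finite V] in
theorem deg_of_ne (h : IsFlipAt T H x y a b) {v : V} (h1 : v ≠ x) (h2 : v ≠ y) (h3 : v ≠ a)
    (h4 : v ≠ b) : H.deg v = T.deg v := by
  have : H.graph.neighborSet v = T.graph.neighborSet v := by
    ext w
    simp only [SimpleGraph.mem_neighborSet, h.adj_iff, Sym2.eq_iff]
    grind
  rw [EmbeddedGraph.deg, this, EmbeddedGraph.deg]

/-- Flipping back: the flip of `ab` to `yx` undoes the flip of `xy` to `ab`. -/
theorem symm {T' : Triangulation V} (h : IsFlipAt T T'.toEmbeddedGraph x y a b) :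
    IsFlipAt T' T.toEmbeddedGraph a b y x := by
  classical
  obtain ⟨⟨n1, n2, n3⟩, n4, n5, n6⟩ := h.new_turns
  have hr := h.rot_not_adj
  have hn := h.not_adj
  refine ⟨n1, n4, h.turn₁.1.ne.symm, ?_, ?_, ?_, ?_, ?_, ?_, ?_⟩
  · have h1 := h.turn₁.adj₃₁.ne
    have h2 := h.turn₁.adj₂₃.ne
    rw [h.adj_iff, Sym2.eq_swap, Sym2.eq_iff]
    grind
  · ext v w
    have hxy := h.turn₁.1
    have hyx := h.turn₁.1.symm
    have hn' : ¬ T.graph.Adj b a := fun e => hn e.symm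
    rw [flip_adj hxy.ne.symm, h.adj_iff]
    simp only [ne_eq, Sym2.eq_iff]
    grind
  · rw [h.rot₃, cyclicErase_cyclicInsertAfter hr.1]
  · rw [h.rot₄, cyclicErase_cyclicInsertAfter hr.2]
  · rw [h.rot₂, cyclicInsertAfter_cyclicErase h.turn₂.rot₁]
  · rw [h.rot₁, cyclicInsertAfter_cyclicErase h.turn₁.rot₁]
  · intro v h1 h2 h3 h4
    rw [h.rot_of_ne v h4 h3 h1 h2]

omit [Finite V] in
theorem rev (h : IsFlipAt T H x y a b) : IsFlipAt T H y x b a where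
  turn₁ := h.turn₂
  turn₂ := h.turn₁
  ne := h.ne.symm
  not_adj := fun e => h.not_adj e.symm
  graph_eq := by rw [h.graph_eq, Sym2.eq_swap, SimpleGraph.edge_comm]
  rot₁ := h.rot₂
  rot₂ := h.rot₁
  rot₃ := h.rot₄
  rot₄ := h.rot₃
  rot_of_ne := fun v h1 h2 h3 h4 => h.rot_of_ne v h2 h1 h4 h3

theorem deg₄ (h : IsFlipAt T H x y a b) : H.deg b = T.deg b + 1 := h.rev.deg₃

end IsFlipAt

theorem exists_isFlipAt (h₁ : T.Turn x y a) (h₂ : T.Turn y x b) (hab : a ≠ b)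
    (hn : ¬ T.graph.Adj a b) : ∃ T' : Triangulation V, IsFlipAt T T'.toEmbeddedGraph x y a b :=
  have h := isFlipAt_flipGraph h₁ h₂ hab hn
  ⟨h.isTriangular.triangulation h.connected h.ncard_edgeSet, h⟩

theorem IsFlip.symm {T T' : Triangulation V} (h : IsFlip T T') : IsFlip T' T := by
  obtain ⟨x, y, a, b, h⟩ := isFlip_iff.1 h
  exact isFlip_iff.2 ⟨_, _, _, _, h.symm⟩

end Triangulation

/-! ### Homology modulo 2 of a plane embedding -/

namespace EmbeddedGraph

variable {V : Type*} (G : EmbeddedGraph V)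

/-- The directed edge following `d` in the cyclic order around its first vertex. -/
noncomputable def rotDart [Finite V] : Equiv.Perm G.graph.Dart :=
  Equiv.ofBijective (fun d => G.faceNext d.symm)
    (Finite.injective_iff_bijective.1 (G.faceNext_injective.comp SimpleGraph.Dart.symm_involutive.injective))

variable [Fintype V] [DecidableEq V] [DecidableRel G.graph.Adj]

/-- The boundary modulo 2 of a set of faces. -/
def faceBoundary : (G.faces → ZMod 2) →ₗ[ZMod 2] (G.graph.edgeSet → ZMod 2) where
  toFun f e := ∑ d : G.graph.Dart with d.edge = e.1, f ⟨G.face d, d, rfl⟩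
  map_add' f g := by ext e; simp [Finset.sum_add_distrib]
  map_smul' c f := by ext e; simp [Finset.mul_sum]

/-- The boundary modulo 2 of a set of edges. -/
def edgeBoundary : (G.graph.edgeSet → ZMod 2) →ₗ[ZMod 2] (V → ZMod 2) where
  toFun g v := ∑ d : G.graph.Dart with d.fst = v, g ⟨d.edge, d.edge_mem⟩
  map_add' f g := by ext e; simp [Finset.sum_add_distrib]
  map_smul' c f := by ext e; simp [Finset.mul_sum]

theorem faceBoundary_apply (f : G.faces → ZMod 2) (d : G.graph.Dart) :
    G.faceBoundary f ⟨d.edge, d.edge_mem⟩ =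
      f ⟨G.face d, d, rfl⟩ + f ⟨G.face d.symm, d.symm, rfl⟩ := by
  change ∑ d' : G.graph.Dart with d'.edge = d.edge, f ⟨G.face d', d', rfl⟩ = _
  rw [SimpleGraph.Dart.edge_fiber, Finset.sum_pair d.symm_ne.symm]

theorem edgeBoundary_single {u v : V} (h : G.graph.Adj u v) :
    G.edgeBoundary (Pi.single ⟨s(u, v), h⟩ 1) = Pi.single u 1 + Pi.single v 1 := by
  ext w
  change ∑ d : G.graph.Dart with d.fst = w,
    (Pi.single ⟨s(u, v), h⟩ 1 : G.graph.edgeSet → ZMod 2) ⟨d.edge, d.edge_mem⟩ = _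
  have : ∀ d : G.graph.Dart,
      (Pi.single ⟨s(u, v), h⟩ 1 : G.graph.edgeSet → ZMod 2) ⟨d.edge, d.edge_mem⟩ =
      if d.edge = (SimpleGraph.Dart.mk (u, v) h).edge then 1 else 0 := by
    intro d
    rw [Pi.single_apply]
    exact if_congr Subtype.ext_iff rfl rfl
  simp_rw [this]
  rw [Finset.sum_filter, Finset.sum_congr rfl (g := fun d =>
    if d.edge = (SimpleGraph.Dart.mk (u, v) h).edge then (if d.fst = w then 1 else 0) else 0)
    (by intros; split_ifs <;> rfl), ← Finset.sum_filter, SimpleGraph.Dart.edge_fiber,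
    Finset.sum_pair (SimpleGraph.Dart.symm_ne _).symm]
  simp [Pi.single_apply, SimpleGraph.Dart.symm, eq_comm]
  congr

/-- Rotation about `v` turns the face to one side of each edge at `v` into the face to the other
side of the next edge. The two sums over the edges at `v` therefore agree and cancel modulo 2. -/
theorem edgeBoundary_faceBoundary (f : G.faces → ZMod 2) :
    G.edgeBoundary (G.faceBoundary f) = 0 := by
  ext v
  change ∑ d : G.graph.Dart with d.fst = v, G.faceBoundary f ⟨d.edge, d.edge_mem⟩ = 0
  simp_rw [faceBoundary_apply]
  rw [Finset.sum_add_distrib]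
  have : ∑ d : G.graph.Dart with d.fst = v, f ⟨G.face d.symm, d.symm, rfl⟩ =
      ∑ d : G.graph.Dart with d.fst = v, f ⟨G.face d, d, rfl⟩ := by
    refine Finset.sum_equiv G.rotDart ?_ ?_
    · intro d
      simp only [Finset.mem_filter, Finset.mem_univ, true_and]
      rfl
    · intro d _
      congr 2
      exact (G.face_faceNext d.symm).symm
  rw [this, CharTwo.add_self_eq_zero]

variable {G}

omit [DecidableEq V] [DecidableRel G.graph.Adj] in
/-- A function on the directed edges that is constant along faces and across edges is constant. -/
theorem eq_of_faceNext_of_symm {α : Type*} (hc : G.graph.Connected) {g : G.graph.Dart → α}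
    (h1 : ∀ d, g (G.faceNext d) = g d) (h2 : ∀ d, g d.symm = g d) (d e : G.graph.Dart) :
    g d = g e := by
  have key : ∀ (v a b : V) (ha : G.graph.Adj v a) (hb : G.graph.Adj v b),
      g ⟨(v, a), ha⟩ = g ⟨(v, b), hb⟩ := by
    intro v a b ha hb
    refine G.rot_induction (p := fun b => ∀ hb : G.graph.Adj v b,
      g ⟨(v, a), ha⟩ = g ⟨(v, b), hb⟩) ha (fun _ => rfl) ?_ hb hb
    intro t ht h hb'
    rw [h ht, ← h2 ⟨(v, t), ht⟩, ← h1]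
    rfl
  have walk : ∀ u v, G.graph.Reachable u v → ∀ (a b : V) (ha : G.graph.Adj u a)
      (hb : G.graph.Adj v b), g ⟨(u, a), ha⟩ = g ⟨(v, b), hb⟩ := by
    rintro u v ⟨p⟩
    induction p with
    | nil => exact key _
    | cons h p ih =>
      intro a b ha hb
      rw [key _ _ _ ha h, ← ih _ b h.symm hb, ← h2 ⟨(_, _), h⟩]
      rfl
  exact walk _ _ (hc.preconnected d.fst e.fst) _ _ d.adj e.adj

open Module in
/-- In the plane every cycle modulo 2 bounds a set of faces. -/
theorem IsPlane.range_faceBoundary [Fintype G.faces] (h : G.IsPlane) :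
    LinearMap.range G.faceBoundary = LinearMap.ker G.edgeBoundary := by
  obtain ⟨hc, he⟩ := h
  refine Submodule.eq_of_le_of_finrank_le ?_ ?_
  · rintro _ ⟨f, rfl⟩
    exact G.edgeBoundary_faceBoundary f
  have hF : G.faces.ncard = finrank (ZMod 2) (G.faces → ZMod 2) := by
    rw [finrank_fintype_fun_eq_card, Set.ncard_eq_toFinset_card', Set.toFinset_card]
  have hE : G.graph.edgeSet.ncard = finrank (ZMod 2) (G.graph.edgeSet → ZMod 2) := by
    rw [finrank_fintype_fun_eq_card, Set.ncard_eq_toFinset_card', Set.toFinset_card]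
  have hV : Nat.card V = finrank (ZMod 2) (V → ZMod 2) := by
    rw [finrank_fintype_fun_eq_card, Nat.card_eq_fintype_card]
  have h2 := G.faceBoundary.finrank_range_add_finrank_ker
  have h1 := G.edgeBoundary.finrank_range_add_finrank_ker
  -- A set of faces without boundary agrees on the two sides of every edge, so by connectedness it
  -- is empty or everything.
  have hk : finrank (ZMod 2) (LinearMap.ker G.faceBoundary) ≤ 1 := by
    refine (Submodule.finrank_mono (t := Submodule.span (ZMod 2) {1}) ?_).trans
      ((finrank_span_le_card _).trans (by simp))
    intro f hf
    rw [Submodule.mem_span_singleton]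
    rw [LinearMap.mem_ker] at hf
    have hs : ∀ d : G.graph.Dart, f ⟨G.face d.symm, d.symm, rfl⟩ = f ⟨G.face d, d, rfl⟩ := by
      intro d
      have := G.faceBoundary_apply f d
      rw [hf, Pi.zero_apply] at this
      rw [← sub_eq_zero, CharTwo.sub_eq_add, add_comm, ← this]
    by_cases hn : Nonempty G.graph.Dart
    · obtain ⟨d⟩ := hn
      refine ⟨f ⟨G.face d, d, rfl⟩, ?_⟩
      ext ⟨_, e, rfl⟩
      have := eq_of_faceNext_of_symm hc (g := fun d => f ⟨G.face d, d, rfl⟩)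
        (fun d => by congr 2; exact G.face_faceNext d) hs d e
      simpa using this
    · refine ⟨0, ?_⟩
      ext ⟨_, e, rfl⟩
      exact absurd ⟨e⟩ hn
  -- Modulo boundaries of edges, every vertex equals `v₀` along a walk. With this rank bound and
  -- `hk`, Euler's formula closes the dimension count.
  have hr : finrank (ZMod 2) (V → ZMod 2) ≤ finrank (ZMod 2) (LinearMap.range G.edgeBoundary) + 1 := by
    obtain ⟨v₀⟩ := hc.nonempty
    have htop : LinearMap.range G.edgeBoundary ⊔ Submodule.span (ZMod 2) {Pi.single v₀ 1} = ⊤ := by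
      rw [eq_top_iff, ← (Pi.basisFun (ZMod 2) V).span_eq, Submodule.span_le]
      rintro _ ⟨v, rfl⟩
      rw [Pi.basisFun_apply]
      obtain ⟨p⟩ := hc.preconnected v v₀
      induction p with
      | nil => exact Submodule.mem_sup_right (Submodule.mem_span_singleton_self _)
      | @cons u v w hadj p ih =>
        have := Submodule.add_mem _ (Submodule.mem_sup_left
          (T := Submodule.span (ZMod 2) {Pi.single w 1}) (⟨_, G.edgeBoundary_single hadj⟩ :
          (Pi.single u 1 + Pi.single v 1 : V → ZMod 2) ∈ LinearMap.range G.edgeBoundary)) ih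
        have h0 : (Pi.single v 1 + Pi.single v 1 : V → ZMod 2) = 0 :=
          funext fun _ => CharTwo.add_self_eq_zero _
        rwa [add_assoc, h0, add_zero] at this
    rw [← finrank_top (ZMod 2) (V → ZMod 2), ← htop]
    refine (Submodule.finrank_add_le_finrank_add_finrank _ _).trans ?_
    gcongr
    exact (finrank_span_le_card _).trans (by simp)
  omega

end EmbeddedGraph

/-! ### Triangles separate the sphere; chords of a link do not cross -/

namespace Triangulation

variable {V : Type*} [Finite V] {T : Triangulation V}

open Classical in
/-- A closed walk of length three separates the sphere into two sides. -/
theorem exists_sides {a b c : V} (hab : T.graph.Adj a b) (hbc : T.graph.Adj b c)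
    (hca : T.graph.Adj c a) : ∃ f : V → V → ZMod 2,
      (∀ u v, T.graph.Adj u v → f v (T.rot v u) = f u v) ∧
      (∀ u v, T.graph.Adj u v → f v u = f u v +
        if s(u, v) = s(a, b) ∨ s(u, v) = s(b, c) ∨ s(u, v) = s(c, a) then 1 else 0) := by
  have := Fintype.ofFinite V
  have := Fintype.ofFinite T.faces
  set χ : T.graph.edgeSet → ZMod 2 := Pi.single ⟨s(a, b), hab⟩ 1 + Pi.single ⟨s(b, c), hbc⟩ 1 +
    Pi.single ⟨s(c, a), hca⟩ 1 with hχ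
  have hmem : χ ∈ LinearMap.ker T.edgeBoundary := by
    rw [LinearMap.mem_ker, hχ, map_add, map_add, T.edgeBoundary_single, T.edgeBoundary_single,
      T.edgeBoundary_single]
    ext v
    simp only [Pi.add_apply, Pi.zero_apply]
    generalize (Pi.single a 1 : V → ZMod 2) v = p
    generalize (Pi.single b 1 : V → ZMod 2) v = q
    generalize (Pi.single c 1 : V → ZMod 2) v = r
    exact (by decide : ∀ p q r : ZMod 2, p + q + (q + r) + (r + p) = 0) p q r
  rw [← T.isPlane.range_faceBoundary] at hmem
  obtain ⟨f, hf⟩ := hmem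
  refine ⟨fun u v => if h : T.graph.Adj u v then f ⟨T.face ⟨(u, v), h⟩, _, rfl⟩ else 0, ?_, ?_⟩
  · intro u v h
    simp only [T.adj_rot h, h, dif_pos]
    congr 2
    exact T.face_faceNext ⟨(u, v), h⟩
  · intro u v h
    simp only [h, h.symm, dif_pos]
    have := T.faceBoundary_apply f ⟨(u, v), h⟩
    rw [hf] at this
    have e : (if s(u, v) = s(a, b) ∨ s(u, v) = s(b, c) ∨ s(u, v) = s(c, a) then 1 else 0 : ZMod 2)
        = χ ⟨s(u, v), h⟩ := by
      have h1 : s(a, b) ≠ s(b, c) := by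
        have := hab.ne; have := hbc.ne; have := hca.ne
        rw [ne_eq, Sym2.eq_iff]; grind
      have h2 : s(a, b) ≠ s(c, a) := by
        have := hab.ne; have := hbc.ne; have := hca.ne
        rw [ne_eq, Sym2.eq_iff]; grind
      have h3 : s(b, c) ≠ s(c, a) := by
        have := hab.ne; have := hbc.ne; have := hca.ne
        rw [ne_eq, Sym2.eq_iff]; grind
      simp only [hχ, Pi.add_apply, Pi.single_apply]
      grind
    rw [e]
    change _ = f _ + χ ⟨(SimpleGraph.Dart.mk (u, v) h).edge, _⟩
    rw [this, ← add_assoc, CharTwo.add_self_eq_zero, zero_add]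
    rfl

/-- Two chords of the link of a vertex `v` do not cross: if `x`, `y`, `w`, `z` occur in this order
around `v`, then `xw` and `yz` are not both edges. -/
theorem not_adj_of_adj {v x y w z : V} (hx : T.graph.Adj v x) (hxw : T.graph.Adj x w)
    (hvy : T.graph.Adj v y) (hxy : T.rot v x = y ∨ T.rot v (T.rot v x) = y) (hyw : T.rot v y = w)
    (hwz : T.rot v w = z) (h1 : x ≠ y) (h2 : x ≠ z) (h3 : y ≠ w) (h4 : w ≠ z) :
    ¬ T.graph.Adj y z := by
  classical
  intro hyz
  have hvw : T.graph.Adj v w := by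
    rw [← hyw]; exact T.adj_rot hvy.symm
  have hvz : T.graph.Adj v z := by
    rw [← hwz]; exact T.adj_rot hvw.symm
  obtain ⟨f, hf1, hf2⟩ := T.exists_sides hx hxw hvw.symm
  have hyz' := hyz.ne
  have step : ∀ u, T.graph.Adj v u → f v (T.rot v u) = f v u +
      if u = x ∨ u = w then 1 else 0 := by
    intro u hu
    rw [hf1 _ _ hu.symm, hf2 _ _ hu]
    congr 2
    have := hu.ne
    rw [Sym2.eq_iff, Sym2.eq_iff, Sym2.eq_iff]
    have := hx.ne
    have := hvw.ne
    grind
  -- All faces at a vertex off the triangle lie on one side of it.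
  have const : ∀ u, u ≠ v → u ≠ x → u ≠ w → ∀ s t, T.graph.Adj u s → T.graph.Adj u t →
      f u s = f u t := by
    intro u h1 h2 h3 s t hs ht
    refine T.rot_induction (p := fun t => f u s = f u t) hs rfl ?_ ht
    intro t ht h
    rw [h, hf1 _ _ ht.symm, hf2 _ _ ht, if_neg, add_zero]
    rw [Sym2.eq_iff, Sym2.eq_iff, Sym2.eq_iff]
    grind
  have flip : ∀ u t, T.graph.Adj u t → u ≠ v → u ≠ x → u ≠ w → f t u = f u t := by
    intro u t hu h1 h2 h3
    rw [hf2 _ _ hu, if_neg, add_zero]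
    rw [Sym2.eq_iff, Sym2.eq_iff, Sym2.eq_iff]
    grind
  have e1 : f v y = f v x + 1 := by
    have := step x hx
    rw [if_pos (.inl rfl)] at this
    rcases hxy with e | e
    · rw [← this, e]
    · rw [← this, ← e, step _ (T.adj_rot hx.symm), if_neg, add_zero]
      rintro (e' | e')
      · rw [e', e'] at e; exact h1 e
      · rw [e', hwz] at e; exact hyz' e.symm
  have e2 : f v w = f v y := by
    rw [← hyw, step y hvy, if_neg, add_zero]
    rintro (e | e)
    exacts [h1 e.symm, h3 e]
  have e3 : f v z = f v w + 1 := by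
    rw [← hwz, step w hvw, if_pos (.inr rfl)]
  -- The edge `yz` would put `y` and `z` on the same side, whereas `e2` and `e3` put them on
  -- opposite sides.
  have e4 : f v y = f v z := by
    rw [flip y v hvy.symm hvy.ne.symm h1.symm h3, flip z v hvz.symm hvz.ne.symm h2.symm h4.symm,
      const y hvy.ne.symm h1.symm h3 _ z hvy.symm hyz,
      const z hvz.ne.symm h2.symm h4.symm _ y hvz.symm hyz.symm,
      flip z y hyz.symm hvz.ne.symm h2.symm h4.symm]
  rw [e3, e2] at e4
  generalize f v y = p at e4
  revert e4 p
  decide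

end Triangulation

/-! ### Flipping a triangulation to a fan -/

namespace Triangulation

section

variable {V : Type*}

theorem FlipSequence.trans {k l : ℕ} {T T' T'' : Triangulation V} (h : FlipSequence k T T')
    (h' : FlipSequence l T' T'') : FlipSequence (k + l) T T'' := by
  induction h' with
  | refl => exact h
  | step _ hf ih => exact (ih h).step hf

theorem IsFlip.flipSequence {T T' : Triangulation V} (h : IsFlip T T') : FlipSequence 1 T T' :=
  (FlipSequence.refl T).step h

theorem IsFlipAt.isFlip {T T' : Triangulation V} {x y a b : V}
    (h : IsFlipAt T T'.toEmbeddedGraph x y a b) : IsFlip T T' :=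
  isFlip_iff.2 ⟨x, y, a, b, h⟩

end

variable {V : Type*} [Finite V] {T : Triangulation V} {x y : V}

/-- The vertices `x` and `p 0` are joined to all vertices of the path `p 1, …, p m`, and there are
no other vertices. -/
structure IsFan (T : Triangulation V) (x : V) (m : ℕ) (p : ℕ → V) : Prop where
  pos : 0 < m
  turn_left : ∀ j ≤ m, T.Turn (p j) x (p (j + 1))
  turn_right : ∀ j, 0 < j → j < m → T.Turn (p (j + 1)) (p 0) (p j)
  closed : p (m + 1) = p 0

/-- The number of flips made is at most the gain in `3 * deg x + deg y`. -/
theorem isFan_or_exists_flipSequence (hxy : T.graph.Adj x y) :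
    (∃ m p, IsFan T x m p) ∨ ∃ k T', 0 < k ∧ FlipSequence k T T' ∧ T'.graph.Adj x y ∧
      3 * T.deg x + T.deg y + k ≤ 3 * T'.deg x + T'.deg y := by
  obtain ⟨p, p0, hp⟩ : ∃ p : ℕ → V, p 0 = y ∧ ∀ j, p (j + 1) = T.rot x (p j) :=
    ⟨fun j => (T.rot x)^[j] y, rfl, fun j => iterate_succ_apply' _ _ _⟩
  obtain ⟨u, u0, hu⟩ : ∃ u : ℕ → V, u 0 = x ∧ ∀ j, u (j + 1) = (T.rot y).symm (u j) :=
    ⟨fun j => (T.rot y).symm^[j] x, rfl, fun j => iterate_succ_apply' _ _ _⟩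
  have pturn : ∀ j, T.Turn (p j) x (p (j + 1)) := by
    intro j
    refine ⟨?_, (hp j).symm⟩
    induction j with
    | zero => rw [p0]; exact hxy.symm
    | succ j ih => rw [hp]; exact (T.adj_rot ih).symm
  have uturn : ∀ j, T.Turn (u (j + 1)) y (u j) := by
    have hadj : ∀ j, T.graph.Adj y (u j) := by
      intro j
      induction j with
      | zero => rw [u0]; exact hxy.symm
      | succ j ih =>
        rw [hu]
        refine (T.rot_isCycleOn y).apply_mem_iff.1 ?_
        rw [Equiv.apply_symm_apply]
        exact ih
    exact fun j => ⟨(hadj _).symm, by rw [hu, Equiv.apply_symm_apply]⟩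
  have h1 : p 1 = u 1 := by
    have h1 := pturn 0
    have h2 := uturn 0
    rw [p0] at h1
    rw [u0] at h2
    exact h1.prev.eq₁ h2
  -- The `p j` run around `x` from `y`, and the `u j` run around `y` from `x` in the opposite
  -- direction. They must separate, since the `p j` return to `y` while each `u j` is a neighbour of
  -- `y`.
  have hex : ∃ j, p (j + 1) ≠ u (j + 1) := by
    by_contra! hall
    obtain ⟨k, hk, hpk⟩ := (T.rot x).injective.mem_periodicPts y
    have hpe : ∀ j, p j = (T.rot x)^[j] y := by
      intro j
      induction j with
      | zero => exact p0
      | succ j ih => rw [hp, ih, iterate_succ_apply']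
    have h2 := hall (k - 1)
    rw [Nat.sub_add_cancel hk, hpe, hpk.eq] at h2
    have h3 := uturn (k - 1)
    rw [Nat.sub_add_cancel hk, ← h2] at h3
    exact h3.1.ne rfl
  classical
  obtain ⟨i, hi, hmin⟩ : ∃ i, p (i + 1) ≠ u (i + 1) ∧ ∀ j < i, p (j + 1) = u (j + 1) :=
    ⟨Nat.find hex, Nat.find_spec hex, fun j hj => not_not.1 (Nat.find_min hex hj)⟩
  obtain ⟨i, rfl⟩ : ∃ j, i = j + 1 := Nat.exists_eq_add_one.2
    (Nat.pos_of_ne_zero (by rintro rfl; exact hi h1))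
  have hv : p (i + 1) = u (i + 1) := hmin i (by omega)
  have hw := uturn (i + 1)
  rw [← hv] at hw
  have hvx := pturn (i + 1)
  have hvx' := pturn i
  have hi' : u (i + 1 + 1) ≠ p (i + 1 + 1) := fun e => hi e.symm
  obtain ⟨w, hwu⟩ : ∃ w, w = u (i + 1 + 1) := ⟨_, rfl⟩
  rw [← hwu] at hi' hw
  -- The last common vertex is `p (i + 1)`, called `v` below, and `w` follows it around `y`. If `w =
  -- x`, the common vertices exhaust the neighbours of `y`, and the fan closes.
  by_cases hwx : w = x
  · subst hwx
    left
    refine ⟨i + 1, p, by omega, fun j _ => pturn j, ?_, ?_⟩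
    · intro j hj hj'
      obtain ⟨j, rfl⟩ := Nat.exists_eq_add_one.2 hj
      have := uturn (j + 1)
      rwa [p0, hmin j (by omega), hmin (j + 1) hj']
    · rw [p0]
      exact hvx.next.eq₂ hw
  right
  have hwy := hw.adj₁₂.ne
  have hyv := hw.adj₂₃.ne
  have hwv := hw.adj₃₁.ne
  have hxy' := hxy.ne
  have hvx'' := hvx.adj₁₂.ne
  -- If `xw` is an edge, `vw` is flipped to `yz`, where `z` is the apex opposite `y`. This raises
  -- `deg y` and keeps `deg x`; the chords `xw` and `yz` of the link of `v` would cross, so `yz` is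
  -- not yet an edge.
  by_cases hadj : T.graph.Adj x w
  · have hz := T.turn_of_adj hw.adj₃₁.symm
    obtain ⟨z, hzz⟩ : ∃ z, z = T.rot (p (i + 1)) w := ⟨_, rfl⟩
    rw [← hzz] at hz
    have hxz : x ≠ z := by
      rintro rfl
      exact hi' (hz.eq₁ hvx.prev)
    have hyz : z ≠ y := by
      rintro rfl
      have := T.rot_induction (p := fun t => t = w ∨ t = z) hw.adj₃₁ (.inl rfl) (by
        rintro t - (rfl | rfl)
        · exact .inr hz.rot₂
        · exact .inl hw.next.rot₂) hvx.1
      grind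
    have hnadj : ¬ T.graph.Adj y z := by
      refine T.not_adj_of_adj hvx.1 hadj hw.adj₂₃.symm ?_ hw.next.rot₂ hz.rot₂ hxy' hxz hwy.symm
        hz.adj₃₁.ne.symm
      -- Around `v`, the vertex `y` comes directly after `x` if `i = 0`, and otherwise after `x` and
      -- `p i`.
      obtain rfl | ⟨j, rfl⟩ : i = 0 ∨ ∃ j, i = j + 1 := by cases i <;> simp
      · left
        rw [hvx'.next.rot₂, p0]
      · right
        rw [hvx'.next.rot₂, hmin j (by omega), hv]
        exact (uturn _).prev.rot₂
    obtain ⟨T', hT'⟩ := exists_isFlipAt hz hw.prev hyz fun e => hnadj e.symm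
    refine ⟨1, T', one_pos, hT'.isFlip.flipSequence, hT'.adj_iff.2 (.inl ⟨hxy, ?_⟩), ?_⟩
    · rw [ne_eq, Sym2.eq_iff]; grind
    · rw [hT'.deg₄, hT'.deg_of_ne (Ne.symm hwx) hvx''.symm hxz hxy']
      omega
  -- For `i = 0` the edge `vy` lies between `x` and `w` and is flipped to `xw`: one flip, gain `3 -
  -- 1`.
  · obtain rfl | ⟨j, rfl⟩ : i = 0 ∨ ∃ j, i = j + 1 := by cases i <;> simp
    · rw [p0] at hvx'
      obtain ⟨T', hT'⟩ := exists_isFlipAt hw.next hvx'.prev hwx fun e => hadj e.symm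
      refine ⟨1, T', one_pos, hT'.isFlip.flipSequence, hT'.adj_iff.2 (.inl ⟨hxy, ?_⟩), ?_⟩
      · rw [ne_eq, Sym2.eq_iff]; grind
      · have := hT'.deg₁
        rw [hT'.deg₄]
        omega
    -- Here `b = p (j + 1)` separates `v` from `p j`. Flipping `vy` to `wb` and then `vb` to `wx`
    -- costs two flips and gains `3 - 1`, which is why `deg x` has weight 3.
    · have hv' : p (j + 1) = u (j + 1) := hmin j (by omega)
      have hb := uturn (j + 1)
      rw [← hv, ← hv'] at hb
      have hbx := pturn j
      have hwb : w ≠ p (j + 1) := by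
        rintro rfl
        exact hadj hbx.adj₂₃
      have hbx' := hbx.adj₂₃.ne
      have hby' := hb.adj₂₃.ne
      have hnadj : ¬ T.graph.Adj w (p (j + 1)) := by
        intro e
        -- All neighbours of `b` are among `x`, `y`, `v` and `p j`. Each of them other than `x` and
        -- `y` is adjacent to `x`, unlike `w`.
        have := T.rot_induction (p := fun t => t = x ∨ t = y ∨ t = p (j + 1 + 1) ∨ t = p j)
          hb.adj₂₃.symm (.inr (.inl rfl)) (by
            rintro t - (rfl | rfl | rfl | rfl)
            · exact .inr (.inr (.inr hbx.next.rot₂))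
            · exact .inr (.inr (.inl hb.next.rot₂))
            · exact .inl hvx'.prev.rot₂
            · obtain rfl | ⟨l, rfl⟩ : j = 0 ∨ ∃ l, j = l + 1 := by cases j <;> simp
              · rw [p0]
                exact .inr (.inr (.inl hb.next.rot₂))
              · have h3 := uturn (l + 1)
                rw [← hv', ← hmin l (by omega)] at h3
                exact .inr (.inl h3.prev.rot₂)) e.symm
        rcases this with rfl | rfl | rfl | rfl
        · exact hwx rfl
        · exact hwy rfl
        · exact hadj hvx'.adj₂₃
        · exact hadj hbx.adj₁₂.symm
      obtain ⟨T₁, hT₁⟩ := exists_isFlipAt hw.next hb hwb hnadj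
      have t1 : T₁.Turn (p (j + 1)) (p (j + 1 + 1)) w := hT₁.new_turns.1.1.next
      have t2 : T₁.Turn (p (j + 1 + 1)) (p (j + 1)) x := by
        refine hT₁.turn_of_turn hvx'.prev ?_ ?_ ?_ <;> rw [ne_eq, Sym2.eq_iff] <;> grind
      have hn1 : ¬ T₁.graph.Adj w x := by
        rw [hT₁.adj_iff, not_or, Sym2.eq_iff]
        refine ⟨fun e => hadj e.1.symm, by grind⟩
      obtain ⟨T₂, hT₂⟩ := exists_isFlipAt t1 t2 hwx hn1
      refine ⟨2, T₂, two_pos, hT₁.isFlip.flipSequence.step hT₂.isFlip,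
        hT₂.adj_iff.2 (.inl ⟨hT₁.adj_iff.2 (.inl ⟨hxy, ?_⟩), ?_⟩), ?_⟩
      · rw [ne_eq, Sym2.eq_iff]; grind
      · rw [ne_eq, Sym2.eq_iff]; grind
      · have d1 := hT₁.deg₁
        have d2 := hT₁.deg_of_ne hxy' hvx''.symm (Ne.symm hwx) hbx'
        have d3 := hT₂.deg_of_ne (v := y) hby' hyv hwy.symm hxy'.symm
        have d4 := hT₂.deg₄
        omega

/-- Every triangulation can be flipped to a fan, with at most `4n - 4 - 3 deg x - deg y` flips. -/
theorem exists_flipSequence_isFan (T : Triangulation V) (x y : V) (hxy : T.graph.Adj x y) :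
    ∃ k S m p, FlipSequence k T S ∧ IsFan S x m p ∧
      k + 3 * T.deg x + T.deg y + 4 ≤ 4 * Nat.card V := by
  induction h : 4 * Nat.card V - (3 * T.deg x + T.deg y) using Nat.strong_induction_on
    generalizing T with
  | _ N ih =>
    rcases isFan_or_exists_flipSequence hxy with ⟨m, p, hf⟩ | ⟨k, T', hk, hs, hxy', hd⟩
    · have h1 := T.deg_lt x
      have h2 := T.deg_lt y
      exact ⟨0, T, m, p, .refl T, hf, by omega⟩
    · have h1 := T'.deg_lt x
      have h2 := T'.deg_lt y
      obtain ⟨l, S, m, p, hs', hf, hl⟩ := ih _ (by omega) T' hxy' rfl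
      exact ⟨k + l, S, m, p, hs.trans hs', hf, by omega⟩

end Triangulation

/-! ### Renaming the vertices -/

section Transport

variable {V W : Type*} (e : V ≃ W) (σ : Equiv.Perm V)

theorem permCongr_cyclicErase [DecidableEq V] [DecidableEq W] (w : V) :
    e.permCongr (cyclicErase σ w) = cyclicErase (e.permCongr σ) (e w) := by
  ext t
  simp only [Equiv.permCongr_apply, cyclicErase, Equiv.Perm.mul_apply, Equiv.symm_apply_apply,
    Equiv.swap_apply_def, EmbeddingLike.apply_eq_iff_eq]
  split_ifs <;> rfl

theorem permCongr_cyclicInsertAfter [DecidableEq V] [DecidableEq W] (u w : V) :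
    e.permCongr (cyclicInsertAfter σ u w) = cyclicInsertAfter (e.permCongr σ) (e u) (e w) := by
  ext t
  simp only [Equiv.permCongr_apply, cyclicInsertAfter, Equiv.Perm.mul_apply,
    Equiv.symm_apply_apply, Equiv.swap_apply_def, EmbeddingLike.apply_eq_iff_eq]
  split_ifs <;> rfl

variable {σ} in
theorem isCycleOn_permCongr [Finite V] {s : Set V} (h : σ.IsCycleOn s) :
    (e.permCongr σ).IsCycleOn (e.symm ⁻¹' s) := by
  have : Finite W := Finite.of_equiv V e
  refine isCycleOn_of_mapsTo ?_ ?_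
  · intro t ht
    simp only [Set.mem_preimage, Equiv.permCongr_apply, Equiv.symm_apply_apply] at ht ⊢
    exact h.1.mapsTo ht
  · intro a ha b hb
    have := h.induction (p := fun t => (e.permCongr σ).SameCycle a (e t)) ha
      (by rw [Equiv.apply_symm_apply]) (by
        intro t _ ih
        have : e (σ t) = e.permCongr σ (e t) := by simp
        rwa [this, Equiv.Perm.sameCycle_apply_right]) hb
    rwa [Equiv.apply_symm_apply] at this

end Transport

namespace Triangulation

variable {V W : Type*} [Finite V] (e : V ≃ W)

/-- The triangulation `T` with its vertices renamed. -/
noncomputable def map (T : Triangulation V) : Triangulation W :=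
  let G : EmbeddedGraph W :=
    { graph := T.graph.comap e.symm
      rot := fun v => e.permCongr (T.rot (e.symm v))
      rot_isCycleOn := fun v => isCycleOn_permCongr e (T.rot_isCycleOn (e.symm v))
      rot_eq_self := fun v w h => by
        rw [Equiv.permCongr_apply, T.rot_eq_self _ _ h, Equiv.apply_symm_apply] }
  have i : G.graph ≃g T.graph := SimpleGraph.Iso.comap e.symm T.graph
  have h : G.IsTriangular := by
    rintro u v _ ⟨h, rfl⟩
    have := (T.turn_of_adj h).next
    exact ⟨by simpa [G] using this.1, by simpa [G] using congrArg e this.2⟩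
  have : Finite W := Finite.of_equiv V e
  h.triangulation (i.connected_iff.2 T.connected) (by
    rw [← Nat.card_coe_set_eq, Nat.card_congr i.mapEdgeSet, Nat.card_coe_set_eq, T.ncard_edgeSet,
      Nat.card_congr e])

theorem map_adj {T : Triangulation V} {u v : W} :
    (T.map e).graph.Adj u v ↔ T.graph.Adj (e.symm u) (e.symm v) := Iff.rfl

theorem map_rot {T : Triangulation V} {v : W} :
    (T.map e).rot v = e.permCongr (T.rot (e.symm v)) := rfl

/-- Renaming the vertices gives an isomorphic graph. -/
def mapIso (T : Triangulation V) : (T.map e).graph ≃g T.graph :=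
  SimpleGraph.Iso.comap e.symm T.graph

theorem turn_map {T : Triangulation V} {u v w : V} (h : T.Turn u v w) :
    (T.map e).Turn (e u) (e v) (e w) :=
  ⟨by simpa [map_adj] using h.1, by simpa [map_rot] using h.2⟩

theorem IsFlip.map {T T' : Triangulation V} (h : IsFlip T T') :
    IsFlip (T.map e) (T'.map e) := by
  classical
  obtain ⟨x, y, a, b, h⟩ := isFlip_iff.1 h
  refine isFlip_iff.2 ⟨e x, e y, e a, e b, turn_map e h.turn₁, turn_map e h.turn₂,
    e.injective.ne h.ne, by simpa [map_adj] using h.not_adj, ?_, ?_, ?_, ?_, ?_, ?_⟩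
  · ext v w
    rw [map_adj, h.adj_iff, flip_adj (e.injective.ne h.ne), map_adj]
    simp only [ne_eq, Sym2.eq_iff, Equiv.symm_apply_eq]
  · rw [map_rot, map_rot, e.symm_apply_apply, h.rot₁, permCongr_cyclicErase]
  · rw [map_rot, map_rot, e.symm_apply_apply, h.rot₂, permCongr_cyclicErase]
  · rw [map_rot, map_rot, e.symm_apply_apply, h.rot₃, permCongr_cyclicInsertAfter]
  · rw [map_rot, map_rot, e.symm_apply_apply, h.rot₄, permCongr_cyclicInsertAfter]
  · intro v h1 h2 h3 h4
    rw [map_rot, map_rot, h.rot_of_ne] <;> rwa [ne_eq, Equiv.symm_apply_eq]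

theorem FlipSequence.map {k : ℕ} {T T' : Triangulation V} (h : FlipSequence k T T') :
    FlipSequence k (T.map e) (T'.map e) := by
  induction h with
  | refl => exact .refl _
  | step _ hf ih => exact ih.step (hf.map e)

theorem FlipSequence.symm {k : ℕ} {T T' : Triangulation V} (h : FlipSequence k T T') :
    FlipSequence k T' T := by
  induction h with
  | refl => exact .refl _
  | step _ hf ih =>
    rw [add_comm]
    exact hf.symm.flipSequence.trans ih

/-- A map that preserves turns in both directions is an isomorphism of embedded graphs. -/
theorem map_eq_of_turn {T : Triangulation V} {S : Triangulation W}
    (h : ∀ u v w, T.Turn u v w → S.Turn (e u) (e v) (e w))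
    (h' : ∀ u v w, S.Turn u v w → T.Turn (e.symm u) (e.symm v) (e.symm w)) : T.map e = S := by
  have hadj : ∀ u v, (T.map e).graph.Adj u v ↔ S.graph.Adj u v := by
    intro u v
    rw [map_adj]
    exact ⟨fun hh => by simpa using (h _ _ _ (T.turn_of_adj hh)).1,
      fun hh => (h' _ _ _ (S.turn_of_adj hh)).1⟩
  refine ext_rot (by ext u v; exact hadj u v) fun v => ?_
  ext u
  by_cases huv : S.graph.Adj v u
  · rw [map_rot, Equiv.permCongr_apply, ← Equiv.eq_symm_apply]
    exact (h' _ _ _ (S.turn_of_adj huv.symm)).2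
  · rw [S.rot_eq_self _ _ huv, (T.map e).rot_eq_self _ _ ((hadj v u).not.2 huv)]

end Triangulation

/-! ### Uniqueness of the fan -/

/-- The turns of a fan, with the vertices `x`, `p 0`, `p 1`, … numbered `0`, `1`, `2`, …. -/
inductive FanTurn (m : ℕ) : ℕ → ℕ → ℕ → Prop
  | left (j : ℕ) (h : j < m) : FanTurn m (j + 1) 0 (j + 2)
  | last : FanTurn m (m + 1) 0 1
  | right (j : ℕ) (h : 0 < j) (h' : j < m) : FanTurn m (j + 2) 1 (j + 1)
  | next {a b c : ℕ} (h : FanTurn m a b c) : FanTurn m b c a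

namespace FanTurn

variable {m a b c : ℕ}

/-- Every directed edge in the list also occurs reversed, so a walk around a vertex never leaves the
list. The claim covers all three edges of a face so that the induction passes through `next`. -/
theorem reverse_aux (hm : 0 < m) (h : FanTurn m a b c) :
    (∃ d, FanTurn m b a d) ∧ (∃ d, FanTurn m c b d) ∧ ∃ d, FanTurn m a c d := by
  induction h with
  | left j h =>
    refine ⟨?_, ?_, ?_⟩
    · cases j with
      | zero => exact ⟨_, last.next⟩
      | succ j => exact ⟨_, (left j (by omega)).next⟩
    · obtain h' | rfl : j + 1 < m ∨ m = j + 1 := by omega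
      · exact ⟨_, left (j + 1) h'⟩
      · exact ⟨_, last⟩
    · cases j with
      | zero =>
        obtain h' | rfl : 1 < m ∨ m = 1 := by omega
        · exact ⟨_, (right 1 one_pos h').next⟩
        · exact ⟨_, last.next.next⟩
      | succ j => exact ⟨_, (right (j + 1) j.succ_pos h).next.next⟩
  | last =>
    obtain ⟨m, rfl⟩ := Nat.exists_eq_add_one.2 hm
    refine ⟨⟨_, (left m m.lt_succ_self).next⟩, ⟨_, left 0 hm⟩, ?_⟩
    cases m with
    | zero => exact ⟨_, (left 0 hm).next.next⟩
    | succ m => exact ⟨_, right (m + 1) m.succ_pos (by omega)⟩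
  | right j h h' =>
    refine ⟨?_, ?_, ⟨_, (left j h').next.next⟩⟩
    · obtain h'' | rfl : j + 1 < m ∨ m = j + 1 := by omega
      · exact ⟨_, (right (j + 1) j.succ_pos h'').next⟩
      · exact ⟨_, last.next.next⟩
    · obtain ⟨j, rfl⟩ := Nat.exists_eq_add_one.2 h
      cases j with
      | zero => exact ⟨_, (left 0 hm).next.next⟩
      | succ j => exact ⟨_, right (j + 1) j.succ_pos (by omega)⟩
  | next _ ih => exact ⟨ih.2.1, ih.2.2, ih.1⟩

theorem exists_at (hb : b ≤ m + 1) : ∃ a c, FanTurn m a b c := by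
  cases b with
  | zero => exact ⟨_, _, last⟩
  | succ b =>
    obtain h | rfl : b < m ∨ b = m := by omega
    · exact ⟨_, _, (left b h).next.next⟩
    · exact ⟨_, _, last.next.next⟩

theorem le (h : FanTurn m a b c) : a ≤ m + 1 ∧ b ≤ m + 1 ∧ c ≤ m + 1 := by
  induction h with
  | next _ ih => exact ⟨ih.2.1, ih.2.2, ih.1⟩
  | _ => omega

end FanTurn

namespace Triangulation

variable {V W : Type*} [Finite V]

/-- The vertices of a fan in the numbering used in `FanTurn`. -/
def fanVertex (x : V) (p : ℕ → V) : ℕ → V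
  | 0 => x
  | j + 1 => p j

namespace IsFan

variable {T : Triangulation V} {x : V} {m : ℕ} {p : ℕ → V}

theorem turn (h : IsFan T x m p) {a b c : ℕ} (ht : FanTurn m a b c) :
    T.Turn (fanVertex x p a) (fanVertex x p b) (fanVertex x p c) := by
  induction ht with
  | left j hj => exact h.turn_left j hj.le
  | last =>
    have := h.turn_left m le_rfl
    rwa [h.closed] at this
  | right j hj hj' => exact h.turn_right j hj hj'
  | next _ ih => exact ih.next

theorem exists_of_adj (h : IsFan T x m p) {b : ℕ} (hb : b ≤ m + 1) {t : V}
    (ht : T.graph.Adj (fanVertex x p b) t) : ∃ a c, fanVertex x p a = t ∧ FanTurn m a b c := by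
  obtain ⟨a, c, habc⟩ := FanTurn.exists_at hb
  refine T.rot_induction (p := fun t => ∃ a c, fanVertex x p a = t ∧ FanTurn m a b c)
    (h.turn habc).1.symm ⟨a, c, rfl, habc⟩ ?_ ht
  rintro _ - ⟨a, c, rfl, habc⟩
  obtain ⟨d, hd⟩ := (FanTurn.reverse_aux h.pos habc).2.1
  exact ⟨c, d, (h.turn habc).2.symm, hd⟩

/-- The listed vertices are closed under adjacency and the graph is connected. -/
theorem exists_fanVertex_eq (h : IsFan T x m p) (v : V) : ∃ a ≤ m + 1, fanVertex x p a = v := by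
  have key : ∀ u v, T.graph.Reachable u v → (∃ a ≤ m + 1, fanVertex x p a = v) →
      ∃ a ≤ m + 1, fanVertex x p a = u := by
    rintro u v ⟨w⟩ hv
    induction w with
    | nil => exact hv
    | cons hadj _ ih =>
      obtain ⟨b, hb, rfl⟩ := ih hv
      obtain ⟨a, c, ha, habc⟩ := h.exists_of_adj hb hadj.symm
      exact ⟨a, habc.le.1, ha⟩
  exact key v x (T.connected.preconnected v x) ⟨0, by omega, rfl⟩

theorem ne_zero (h : IsFan T x m p) {d : ℕ} (hd : 0 < d) (hdm : d ≤ m) : p 0 ≠ p d := by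
  obtain hdm | rfl := hdm.lt_or_eq
  · exact (h.turn_right d hd hdm).adj₂₃.ne
  · have := (h.turn_left d le_rfl).adj₃₁.ne
    rwa [h.closed] at this

/-- Rotation about `x` is injective, so a coincidence could be shifted back to one with `p 0`, which
is adjacent to all other path vertices. -/
theorem ne_add (h : IsFan T x m p) (i : ℕ) {d : ℕ} (hd : 0 < d) (hdm : i + d ≤ m) :
    p i ≠ p (i + d) := by
  induction i with
  | zero => rw [zero_add]; exact h.ne_zero hd (by omega)
  | succ i ih =>
    intro e
    refine ih (by omega) ?_
    have h1 := h.turn_left i (by omega)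
    have h2 := h.turn_left (i + d) (by omega)
    rw [show i + d + 1 = i + 1 + d by omega, ← e] at h2
    exact h1.eq₁ h2

theorem injOn (h : IsFan T x m p) {a b : ℕ} (ha : a ≤ m + 1) (hb : b ≤ m + 1)
    (hab : fanVertex x p a = fanVertex x p b) : a = b := by
  wlog hlt : a < b generalizing a b
  · by_contra hne
    exact hne (this hb ha hab.symm (by omega)).symm
  obtain ⟨b, rfl⟩ := Nat.exists_eq_add_one.2 (show 0 < b by omega)
  cases a with
  | zero => exact absurd hab (h.turn_left b (by omega)).1.ne.symm
  | succ a =>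
    refine absurd hab ?_
    have := h.ne_add a (d := b - a) (by omega) (by omega)
    rwa [Nat.add_sub_cancel' (by omega)] at this

theorem exists_equiv (h : IsFan T x m p) :
    ∃ e : Fin (m + 2) ≃ V, ∀ i, e i = fanVertex x p i := by
  refine ⟨Equiv.ofBijective (fun i => fanVertex x p i) ⟨?_, ?_⟩, fun _ => rfl⟩
  · intro i j hij
    exact Fin.ext (h.injOn (by omega) (by omega) hij)
  · intro v
    obtain ⟨a, ha, rfl⟩ := h.exists_fanVertex_eq v
    exact ⟨⟨a, by omega⟩, rfl⟩

theorem exists_fanTurn (h : IsFan T x m p) {u v w : V} (ht : T.Turn u v w) :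
    ∃ a b c, fanVertex x p a = u ∧ fanVertex x p b = v ∧ fanVertex x p c = w ∧
      FanTurn m a b c := by
  obtain ⟨b, hb, rfl⟩ := h.exists_fanVertex_eq v
  obtain ⟨a, c, rfl, habc⟩ := h.exists_of_adj hb ht.1.symm
  exact ⟨a, b, c, rfl, rfl, (h.turn habc).eq₃ ht, habc⟩

/-- Two fans with the same number of vertices are isomorphic as embedded graphs. -/
theorem exists_map_eq [Finite W] {S : Triangulation W} {x' : W} {m' : ℕ} {p' : ℕ → W}
    (h : IsFan T x m p) (h' : IsFan S x' m' p') (hc : Nat.card V = Nat.card W) :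
    ∃ e : V ≃ W, T.map e = S := by
  obtain ⟨f, hf⟩ := h.exists_equiv
  obtain ⟨f', hf'⟩ := h'.exists_equiv
  obtain rfl : m = m' := by
    have h1 := Nat.card_congr f
    have h2 := Nat.card_congr f'
    rw [Nat.card_fin] at h1 h2
    omega
  have key : ∀ a ≤ m + 1, f' (f.symm (fanVertex x p a)) = fanVertex x' p' a := by
    intro a ha
    have := hf ⟨a, by omega⟩
    rw [← this, Equiv.symm_apply_apply, hf']
  have key' : ∀ a ≤ m + 1, f (f'.symm (fanVertex x' p' a)) = fanVertex x p a := by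
    intro a ha
    have := hf' ⟨a, by omega⟩
    rw [← this, Equiv.symm_apply_apply, hf]
  refine ⟨f.symm.trans f', map_eq_of_turn _ ?_ ?_⟩
  · intro u v w ht
    obtain ⟨a, b, c, rfl, rfl, rfl, habc⟩ := h.exists_fanTurn ht
    have hle := habc.le
    simp only [Equiv.trans_apply]
    rw [key a hle.1, key b hle.2.1, key c hle.2.2]
    exact h'.turn habc
  · intro u v w ht
    obtain ⟨a, b, c, rfl, rfl, rfl, habc⟩ := h'.exists_fanTurn ht
    have hle := habc.le
    simp only [Equiv.symm_trans_apply, Equiv.symm_symm]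
    rw [key' a hle.1, key' b hle.2.1, key' c hle.2.2]
    exact h.turn habc

end IsFan

end Triangulation

/-! ### A good starting edge and the final bounds -/

namespace Triangulation

variable {V W : Type*} [Finite V] (T : Triangulation V)

/-- If all neighbours of a vertex `x` of degree at least 5 have degree at most 4, then the
triangulation is a bipyramid over the link of `x`. -/
theorem exists_apex {x : V} (hx : 5 ≤ T.deg x) (h4 : ∀ v, T.graph.Adj x v → T.deg v ≤ 4) :
    ∃ u v w, T.Turn u v w ∧ T.Turn v u x ∧ w ≠ x ∧ ¬ T.graph.Adj w x ∧
      Nat.card V ≤ T.deg x + 2 := by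
  classical
  obtain ⟨y, hy⟩ : ∃ y, T.graph.Adj x y := by
    have : (T.graph.neighborSet x).Nonempty := by
      rw [← Set.ncard_pos]
      exact lt_of_lt_of_le (by norm_num) hx
    exact this
  obtain ⟨p, p0, hp⟩ : ∃ p : ℕ → V, p 0 = y ∧ ∀ j, p (j + 1) = T.rot x (p j) :=
    ⟨fun j => (T.rot x)^[j] y, rfl, fun j => iterate_succ_apply' _ _ _⟩
  have pturn : ∀ j, T.Turn (p j) x (p (j + 1)) := by
    intro j
    refine ⟨?_, (hp j).symm⟩
    induction j with
    | zero => rw [p0]; exact hy.symm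
    | succ j ih => rw [hp]; exact (T.adj_rot ih).symm
  -- A repetition after `d` steps would leave `x` with at most `d` neighbours.
  have dist : ∀ j d, 0 < d → d < 5 → p j ≠ p (j + d) := by
    intro j d hd hd5 e
    have hsub : T.graph.neighborSet x ⊆
        (((Finset.range d).image fun i => p (j + i) : Finset V) : Set V) := by
      intro t ht
      refine T.rot_induction (p := fun t => t ∈ (((Finset.range d).image fun i => p (j + i) :
        Finset V) : Set V)) (pturn j).1.symm ?_ ?_ ht
      · simpa using ⟨0, hd, rfl⟩
      · intro t _ ht
        simp only [Finset.coe_image, Finset.coe_range, Set.mem_image, Set.mem_Iio] at ht ⊢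
        obtain ⟨i, hi, rfl⟩ := ht
        rw [← hp]
        obtain hi' | hi' : i + 1 < d ∨ i + 1 = d := by omega
        · exact ⟨i + 1, hi', rfl⟩
        · exact ⟨0, hd, by rw [add_zero, e, ← hi', add_assoc]⟩
    have h1 := Set.ncard_le_ncard hsub
    rw [Set.ncard_coe_finset] at h1
    have h2 := (Finset.card_image_le (s := Finset.range d) (f := fun i => p (j + i)))
    rw [Finset.card_range] at h2
    rw [EmbeddedGraph.deg] at hx
    omega
  have d1 : ∀ j, p j ≠ p (j + 1) := fun j => dist j 1 (by norm_num) (by norm_num)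
  have d2 : ∀ j, p j ≠ p (j + 2) := fun j => dist j 2 (by norm_num) (by norm_num)
  have d3 : ∀ j, p j ≠ p (j + 3) := fun j => dist j 3 (by norm_num) (by norm_num)
  have d4 : ∀ j, p j ≠ p (j + 4) := fun j => dist j 4 (by norm_num) (by norm_num)
  have few : ∀ (v : V) (l : List V), T.graph.Adj x v → l.Nodup → (∀ t ∈ l, T.graph.Adj v t) →
      l.length ≤ 4 := by
    intro v l hv hl h
    refine le_trans ?_ (h4 v hv)
    rw [EmbeddedGraph.deg, ← List.toFinset_card_of_nodup hl, ← Set.ncard_coe_finset]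
    exact Set.ncard_le_ncard fun t ht => h t (by simpa using ht)
  have wx : ∀ j w, T.Turn (p j) (p (j + 1)) w → w ≠ x := by
    rintro j w h rfl
    exact d2 j ((pturn (j + 1)).prev.eq₁ h).symm
  -- Beyond `x`, `p j` and `p (j + 2)`, the vertex `p (j + 1)` has room for at most one more
  -- neighbour.
  have alt : ∀ j w, T.Turn (p j) (p (j + 1)) w → w = p (j + 2) ∨
      T.Turn w (p (j + 1)) (p (j + 2)) := by
    intro j w h
    by_contra! hc
    have h1 := T.turn_of_adj h.adj₂₃.symm
    obtain ⟨r, hr⟩ : ∃ r, r = T.rot (p (j + 1)) w := ⟨_, rfl⟩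
    rw [← hr] at h1
    have hwx := wx j w h
    have hxp := (pturn (j + 1)).prev
    have hpx := (pturn j).next
    have e1 : r ≠ p (j + 2) := by rintro rfl; exact hc.2 h1
    have e2 : r ≠ x := by rintro rfl; exact hc.1 (h1.eq₁ hxp)
    have e3 : r ≠ p j := by rintro rfl; exact hwx (h1.eq₁ hpx)
    have e4 := h1.adj₃₁.ne
    have e5 := h.adj₃₁.ne
    have e6 := d2 j
    have e7 := (pturn j).1.ne
    have e8 := hxp.adj₃₁.ne
    have := few (p (j + 1)) [r, p (j + 2), x, p j, w] (pturn j).adj₂₃ (by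
      simp only [List.nodup_cons, List.mem_cons, List.not_mem_nil, List.nodup_nil]
      grind) (by
      simp only [List.mem_cons, List.not_mem_nil]
      rintro t (rfl | rfl | rfl | rfl | rfl | h)
      exacts [h1.adj₂₃, hxp.adj₁₂.symm, hxp.adj₂₃, hpx.adj₂₃, h.adj₂₃, h.elim])
    simp at this
  -- If `w = p (j + 3)`, then `alt` at `p (j + 3)` makes `p (j + 1)` adjacent to `p (j + 4)`, its
  -- fifth neighbour. Hence the outer apex is the same along the whole link.
  have step : ∀ j w, T.Turn (p (j + 1)) (p (j + 2)) w → T.Turn w (p (j + 2)) (p (j + 3)) := by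
    intro j w h
    refine (alt (j + 1) w h).resolve_left ?_
    rintro rfl
    have h1 := (alt (j + 2) (p (j + 1)) h.next).resolve_left (d3 (j + 1))
    have := few (p (j + 1)) [p (j + 4), p (j + 3), p (j + 2), x, p j] (pturn j).adj₂₃ (by
      have := d1 (j + 2)
      have := d1 (j + 3)
      have := d2 (j + 2)
      have := d2 j
      have := d3 j
      have := d4 j
      have := (pturn j).1.ne
      have := (pturn (j + 2)).1.ne
      have := (pturn (j + 3)).1.ne
      have := (pturn (j + 4)).1.ne
      simp only [List.nodup_cons, List.mem_cons, List.not_mem_nil, List.nodup_nil]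
      grind) (by
      simp only [List.mem_cons, List.not_mem_nil]
      rintro t (rfl | rfl | rfl | rfl | rfl | h)
      exacts [h1.adj₃₁.symm, h.adj₃₁.symm, h.adj₁₂, (pturn j).adj₂₃.symm, (pturn j).adj₃₁,
        h.elim])
    simp at this
  obtain ⟨w, hw⟩ := T.exists_turn (pturn 1).adj₃₁.symm
  have hturn : ∀ j, T.Turn (p (j + 1)) (p (j + 2)) w := by
    intro j
    induction j with
    | zero => exact hw
    | succ j ih => exact (step j w ih).next
  have hnbr : ∀ t, T.graph.Adj x t → ∃ j, t = p (j + 2) := by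
    intro t ht
    refine T.rot_induction (p := fun t => ∃ j, t = p (j + 2)) (pturn 1).adj₂₃ ⟨0, rfl⟩ ?_ ht
    rintro _ - ⟨j, rfl⟩
    exact ⟨j + 1, (hp _).symm⟩
  have hnadj : ¬ T.graph.Adj w x := by
    intro h
    obtain ⟨j, rfl⟩ := hnbr w h.symm
    exact (hturn j).adj₂₃.ne rfl
  refine ⟨p 1, p 2, w, hw, (pturn 1).prev, wx 1 w hw, hnadj, ?_⟩
  -- The two apices and the link are closed under adjacency, so by connectedness there are no other
  -- vertices.
  have hall : ∀ v, v = x ∨ v = w ∨ T.graph.Adj x v := by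
    have key : ∀ u v, T.graph.Adj u v → (u = x ∨ u = w ∨ T.graph.Adj x u) →
        (v = x ∨ v = w ∨ T.graph.Adj x v) := by
      rintro u v huv (rfl | rfl | hu)
      · exact .inr (.inr huv)
      · refine .inr (.inr (T.rot_induction (p := fun t => T.graph.Adj x t) hw.adj₃₁
          (pturn 0).adj₂₃ ?_ huv))
        intro t _ ht
        obtain ⟨j, rfl⟩ := hnbr t ht
        rw [(hturn j).next.rot₂]
        exact (pturn j).adj₂₃
      · obtain ⟨j, rfl⟩ := hnbr u hu
        have := T.rot_induction (p := fun t => t = x ∨ t = w ∨ t = p (j + 1) ∨ t = p (j + 3))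
          (pturn (j + 1)).adj₃₁ (.inr (.inr (.inl rfl))) (by
            rintro t - (rfl | rfl | rfl | rfl)
            · exact .inr (.inr (.inl (pturn (j + 1)).next.rot₂))
            · exact .inr (.inr (.inr (hturn (j + 1)).prev.rot₂))
            · exact .inr (.inl (hturn j).rot₂)
            · exact .inl (pturn (j + 2)).prev.rot₂) huv
        rcases this with rfl | rfl | rfl | rfl
        · exact .inl rfl
        · exact .inr (.inl rfl)
        · exact .inr (.inr (pturn j).adj₂₃)
        · exact .inr (.inr (pturn (j + 2)).adj₂₃)
    intro v
    obtain ⟨q⟩ := T.connected.preconnected v x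
    have walk : ∀ u v, T.graph.Walk u v → (v = x ∨ v = w ∨ T.graph.Adj x v) →
        (u = x ∨ u = w ∨ T.graph.Adj x u) := by
      intro u v q hv
      induction q with
      | nil => exact hv
      | cons hadj _ ih => exact key _ _ hadj.symm (ih hv)
    exact walk v x q (.inl rfl)
  have hsub : (Set.univ : Set V) ⊆ insert x (insert w (T.graph.neighborSet x)) :=
    fun v _ => hall v
  have h1 := Set.ncard_le_ncard hsub
  rw [Set.ncard_univ] at h1
  have h2 := Set.ncard_insert_le w (T.graph.neighborSet x)
  have h3 := Set.ncard_insert_le x (insert w (T.graph.neighborSet x))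
  rw [EmbeddedGraph.deg]
  omega

/-- A triangulation with at least 7 vertices can be flipped to a fan with at most `4n - 24` flips,
and with at most `4n - 27` flips if it has at least 13 vertices. -/
theorem exists_short_flipSequence_isFan (hn : 7 ≤ Nat.card V) :
    ∃ k S x m p, FlipSequence k T S ∧ IsFan S x m p ∧ k + 24 ≤ 4 * Nat.card V ∧
      (13 ≤ Nat.card V → k + 27 ≤ 4 * Nat.card V) := by
  have fan : ∀ x y, T.graph.Adj x y → 20 ≤ 3 * T.deg x + T.deg y →
      (13 ≤ Nat.card V → 23 ≤ 3 * T.deg x + T.deg y) →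
      ∃ k S x m p, FlipSequence k T S ∧ IsFan S x m p ∧ k + 24 ≤ 4 * Nat.card V ∧
      (13 ≤ Nat.card V → k + 27 ≤ 4 * Nat.card V) := by
    intro x y hxy h1 h2
    obtain ⟨k, S, m, p, hs, hf, hk⟩ := T.exists_flipSequence_isFan x y hxy
    exact ⟨k, S, x, m, p, hs, hf, by omega, fun h => by have := h2 h; omega⟩
  obtain ⟨x, hx, hx'⟩ : ∃ x, 5 ≤ T.deg x ∧ (13 ≤ Nat.card V → 6 ≤ T.deg x) := by
    by_cases h : 13 ≤ Nat.card V
    · obtain ⟨x, hx⟩ := T.exists_deg_gt (c := 5) (by omega)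
      exact ⟨x, by omega, fun _ => hx⟩
    · obtain ⟨x, hx⟩ := T.exists_deg_gt (c := 4) (by omega)
      exact ⟨x, hx, fun h' => absurd h' h⟩
  by_cases h5 : ∃ y, T.graph.Adj x y ∧ 5 ≤ T.deg y
  · obtain ⟨y, hxy, hy⟩ := h5
    exact fan x y hxy (by omega) fun h => by have := hx' h; omega
  push Not at h5
  obtain ⟨u, v, w, huvw, hvux, hwx, hnadj, hcard⟩ :=
    T.exists_apex hx fun v hv => Nat.le_of_lt_succ (h5 v hv)
  -- Any neighbour has degree at least 2, and `3 * 6 + 2 = 20`. For `n ≥ 13` the bipyramid even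
  -- gives `deg x ≥ 11`.
  by_cases h6 : 6 ≤ T.deg x
  · have := T.two_le_deg hvux.adj₂₃
    exact fan x u hvux.adj₂₃.symm (by omega) (by omega)
  -- Now `deg x = 5` and `n = 7`. One flip joins the apices, giving `deg x = 6` and `deg w ≥ 3`:
  -- potential at least 21, which pays for the extra flip.
  · obtain ⟨T', hT'⟩ := exists_isFlipAt huvw hvux hwx hnadj
    obtain ⟨k, S, m, p, hs, hf, hk⟩ := T'.exists_flipSequence_isFan x w
      (hT'.adj_iff.2 (.inr Sym2.eq_swap))
    have h1 := hT'.deg₃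
    have h2 := hT'.deg₄
    have h3 := T.two_le_deg huvw.adj₃₁
    exact ⟨1 + k, S, x, m, p, hT'.isFlip.flipSequence.trans hs, hf, by omega, by omega⟩

/-- After a renaming the two fans are the same embedded graph, so the second sequence, renamed and
reversed, continues the first. -/
theorem transformableWithin_of_isFan [Finite W] {T₁ S₁ : Triangulation V} {T₂ S₂ : Triangulation W}
    {k₁ k₂ m₁ m₂ m : ℕ} {x₁ : V} {x₂ : W} {p₁ : ℕ → V} {p₂ : ℕ → W}
    (h₁ : FlipSequence k₁ T₁ S₁) (h₂ : FlipSequence k₂ T₂ S₂) (hf₁ : IsFan S₁ x₁ m₁ p₁)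
    (hf₂ : IsFan S₂ x₂ m₂ p₂) (hc : Nat.card V = Nat.card W) (hm : k₁ + k₂ ≤ m) :
    TransformableWithin m T₁ T₂ := by
  obtain ⟨e, rfl⟩ := hf₂.exists_map_eq hf₁ hc.symm
  exact ⟨k₁ + k₂, hm, T₂.map e, h₁.trans (h₂.map e).symm, ⟨T₂.mapIso e⟩⟩

end Triangulation

theorem mainTheorem4 {V W : Type*} [Finite V] [Finite W] (n : ℕ)
    (hV : Nat.card V = n) (hW : Nat.card W = n)
    (T₁ : Triangulation V) (T₂ : Triangulation W) :
    (13 ≤ n → Triangulation.TransformableWithin (8 * n - 54) T₁ T₂) ∧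
      (7 ≤ n → Triangulation.TransformableWithin (8 * n - 48) T₁ T₂) := by
  constructor <;> intro hn
  all_goals
    obtain ⟨k₁, S₁, x₁, m₁, p₁, hs₁, hf₁, hk₁, hk₁'⟩ :=
      T₁.exists_short_flipSequence_isFan (by omega)
    obtain ⟨k₂, S₂, x₂, m₂, p₂, hs₂, hf₂, hk₂, hk₂'⟩ :=
      T₂.exists_short_flipSequence_isFan (by omega)
    exact Triangulation.transformableWithin_of_isFan hs₁ hs₂ hf₁ hf₂ (hV.trans hW.symm) (by omega)
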